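/- Let $n\ge 2$ and $0\le m\le n-1$ be integers. A collector draws with replacement from $n$ distinct coupons, the draws being independent and each of them uniformly distributed on the $n$ coupons. Let $W_{n,m}$ be the number of draws needed until, for the first time, $n-m$ distinct coupons have been collected, let $\sigma_n^2=\operatorname{Var}(W_{n,m})$, $\widetilde W_{n,m}=W_{n,m}-(n-m)$, $c=\lfloor \operatorname{Var}\widetilde W_{n,m}-\mathbb E\widetilde W_{n,m}\rfloor$, and let $\mu$ be the distribution of $\widetilde W_{n,m}+c$. For $j\ge 1$ put $$a_{n,j}=\sum_{k=m+1}^{n}\Big(\frac{n-k}{k}\Big)^j .$$ For an integer $R\ge 3$ define the polynomials $$h_R(w)=-a_{n,2}w+a_{n,2}\frac{w^2}{2}+\sum_{r=3}^{R}a_{n,r}\frac{w^r}{r},\qquad H_R(w)=\sum_{l=0}^{3R-2}\frac{h_R(w)^l}{l!},$$ and let $\nu_R$ be the Poisson–Charlier signed measure with characteristic function $$\sum_{k}e^{itk}\nu_R\{k\}=\exp\{\sigma_n^2(e^{it}-1)\}\,H_R(e^{it}-1),\qquad t\in\mathbb R,$$ that is, the finite signed measure on the nonnegative integers with this characteristic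 function. **Theorem.** For every integer $R\ge 3$ there exist a threshold number $n_R$ and a constant $C_R>0$, both depending only on $R$, such that for all $n\ge n_R$ and all $0\le m\le n-1$ with $a_{n,2}<1$, $$\sup_{k\in\mathbb Z}|\mu\{k\}-\nu_R\{k\}|\le C_R\,\frac{1}{(\sqrt n)^{R}} .$$ -/

import Mathlib

open MeasureTheory ProbabilityTheory Polynomial
open scoped NNReal

namespace CouponCollector

/-! ### The waiting time -/

section WaitingTime

variable {Ω : Type*} [MeasurableSpace Ω] {n : ℕ}

/-- The draws `X 0, X 1, X 2, …` are independent, and each of them is uniformly distributed on the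
set `Fin n` of the `n` distinct coupons (sampling with replacement). -/
structure IsUniformSampling (X : ℕ → Ω → Fin n) (P : Measure Ω) : Prop where
  measurable : ∀ i, Measurable (X i)
  indep : iIndepFun X P
  uniform : ∀ i (c : Fin n), P.real (X i ⁻¹' {c}) = 1 / (n : ℝ)

/-- `waitingTime X m ω` is `W_{n,m}(ω)`: the least number `t` of draws such that the first `t` draws
`X 0 ω, …, X (t - 1) ω` show at least `n - m` distinct coupons. -/
noncomputable def waitingTime (X : ℕ → Ω → Fin n) (m : ℕ) (ω : Ω) : ℕ :=
  sInf {t : ℕ | n - m ≤ ((Finset.range t).image (fun i => X i ω)).card}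

/-- The shifted waiting time `W_{n,m} - (n - m)`. -/
noncomputable def shiftedTime (X : ℕ → Ω → Fin n) (m : ℕ) (ω : Ω) : ℤ :=
  (waitingTime X m ω : ℤ) - ((n : ℤ) - (m : ℤ))

/-- The variance `σ_n²` of the waiting time `W_{n,m}`. -/
noncomputable def waitingVar (X : ℕ → Ω → Fin n) (m : ℕ) (P : Measure Ω) : ℝ :=
  variance (fun ω => (waitingTime X m ω : ℝ)) P

/-- The integer `c`: the integer part of the difference of the variance and of the mean of the
shifted waiting time. -/
noncomputable def centering (X : ℕ → Ω → Fin n) (m : ℕ) (P : Measure Ω) : ℤ :=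
  ⌊variance (fun ω => (shiftedTime X m ω : ℝ)) P - ∫ ω, (shiftedTime X m ω : ℝ) ∂P⌋

/-- `μ`, the distribution of `W_{n,m} - (n - m) + c`. -/
noncomputable def centeredLaw (X : ℕ → Ω → Fin n) (m : ℕ) (P : Measure Ω) : Measure ℤ :=
  P.map (fun ω => shiftedTime X m ω + centering X m P)

end WaitingTime

/-! ### The truncated expansion -/

/-- `a_{n,j} = ∑_{k=m+1}^n ((n-k)/k)^j`. -/
noncomputable def aSum (n m j : ℕ) : ℝ :=
  ∑ k ∈ Finset.Icc (m + 1) n, (((n : ℝ) - (k : ℝ)) / (k : ℝ)) ^ j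

/-- `h_R(w) = -a_{n,2} w + a_{n,2} w²/2 + ∑_{r=3}^R a_{n,r} w^r/r`, as a polynomial in `w`. -/
noncomputable def hPoly (R n m : ℕ) : ℝ[X] :=
  -(C (aSum n m 2) * X) + C (aSum n m 2 / 2) * X ^ 2
    + ∑ r ∈ Finset.Icc 3 R, C (aSum n m r / (r : ℝ)) * X ^ r

/-- `H_R(w) = ∑_{l=0}^{3R-2} h_R(w)^l / l!`, as a polynomial in `w`. -/
noncomputable def HPoly (R n m : ℕ) : ℝ[X] :=
  ∑ l ∈ Finset.Icc 0 (3 * R - 2), C (1 / (l.factorial : ℝ)) * hPoly R n m ^ l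

/-! ### Poisson–Charlier signed measures -/

/-- The Poisson distribution with parameter `lam`, shifted by `k`, as a signed measure on `ℤ`. -/
noncomputable def poissonShift (lam : ℝ≥0) (k : ℕ) : SignedMeasure ℤ :=
  ((poissonMeasure lam).map (fun j : ℕ => (j : ℤ) + (k : ℤ))).toSignedMeasure

/-- The Poisson–Charlier signed measure with parameter `lam` and coefficient polynomial
`H(w) = ∑_r a_r w^r`: the finite signed measure, concentrated on the nonnegative integers, whose
characteristic function is `exp(lam (e^{it} - 1)) H(e^{it} - 1)`
(`hasSum_poissonCharlier` below; its point masses in terms of the Charlier polynomials are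
computed in `poissonCharlier_natCast`).

Multiplying the characteristic function of the Poisson distribution by `(e^{it} - 1)^r` means taking
the `r`-th difference `∑_k (-1)^{r-k} (r choose k) Po(lam)(· - k)`, and so the measure is
the corresponding combination of shifted Poisson distributions. -/
noncomputable def poissonCharlier (lam : ℝ≥0) (H : ℝ[X]) : SignedMeasure ℤ :=
  ∑ r ∈ Finset.range (H.natDegree + 1), H.coeff r •
    ∑ k ∈ Finset.range (r + 1), ((-1 : ℝ) ^ (r - k) * (r.choose k : ℝ)) • poissonShift lam k

/-- The `r`-th Charlier polynomial
`C_r(j, lam) = ∑_{k=0}^r (-1)^k (r choose k) (j choose k) k! lam^{-k}`. -/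
noncomputable def charlier (r j : ℕ) (lam : ℝ) : ℝ :=
  ∑ k ∈ Finset.range (r + 1),
    (-1 : ℝ) ^ k * (r.choose k : ℝ) * (j.choose k : ℝ) * (k.factorial : ℝ) * (lam ^ k)⁻¹

theorem poissonShift_singleton (lam : ℝ≥0) (k : ℕ) (i : ℤ) :
    poissonShift lam k {i}
      = if (k : ℤ) ≤ i then (poissonMeasure lam).real {(i - k).toNat} else 0 := by
  have h1 : poissonShift lam k {i}
      = (poissonMeasure lam).real ((fun j : ℕ => (j : ℤ) + (k : ℤ)) ⁻¹' {i}) := by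
    rw [poissonShift, Measure.toSignedMeasure_apply_measurable (MeasurableSet.singleton i),
      map_measureReal_apply .of_discrete (MeasurableSet.singleton i)]
  rw [h1]
  split_ifs with h
  · congr 1
    ext j
    simp only [Set.mem_preimage, Set.mem_singleton_iff]
    omega
  · have : (fun j : ℕ => (j : ℤ) + (k : ℤ)) ⁻¹' {i} = ∅ := by
      ext j
      simp only [Set.mem_preimage, Set.mem_singleton_iff, Set.mem_empty_iff_false, iff_false]
      omega
    rw [this, measureReal_empty]

theorem hasSum_poissonShift (lam : ℝ≥0) (k : ℕ) (t : ℝ) :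
    HasSum (fun i : ℤ => ((poissonShift lam k {i} : ℝ) : ℂ) * Complex.exp (Complex.I * t * i))
      (Complex.exp (lam * (Complex.exp (Complex.I * t) - 1))
        * Complex.exp (Complex.I * t) ^ k) := by
  have hinj : Function.Injective (fun j : ℕ => (j : ℤ) + (k : ℤ)) := fun a b h => by
    simp only at h
    omega
  rw [← hinj.hasSum_iff]
  · have h := (NormedSpace.expSeries_div_hasSum_exp
      ((lam : ℂ) * Complex.exp (Complex.I * t))).mul_left
        (Complex.exp (-lam) * Complex.exp (Complex.I * t) ^ k)
    rw [← Complex.exp_eq_exp_ℂ] at h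
    convert! h using 1
    · ext j
      simp only [Function.comp_apply, poissonShift_singleton]
      rw [if_pos (by omega), poissonMeasure_real_singleton]
      have : ((j : ℤ) + k - k).toNat = j := by omega
      rw [this]
      push_cast
      rw [mul_pow, ← Complex.exp_nat_mul, ← Complex.exp_nat_mul, mul_add, Complex.exp_add,
        mul_comm (Complex.I * (t : ℂ)) (j : ℂ), mul_comm (Complex.I * (t : ℂ)) (k : ℂ)]
      ring
    · rw [mul_sub, mul_one, sub_eq_add_neg, Complex.exp_add]
      ring
  · intro i hi
    rw [poissonShift_singleton, if_neg, Complex.ofReal_zero, zero_mul]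
    intro h
    exact hi ⟨(i - k).toNat, by simp only; omega⟩

theorem poissonCharlier_singleton (lam : ℝ≥0) (H : ℝ[X]) (i : ℤ) :
    poissonCharlier lam H {i} = ∑ r ∈ Finset.range (H.natDegree + 1), H.coeff r *
      ∑ k ∈ Finset.range (r + 1), ((-1 : ℝ) ^ (r - k) * (r.choose k : ℝ)) *
        poissonShift lam k {i} := by
  have hsum : ∀ (s : Finset ℕ) (f : ℕ → SignedMeasure ℤ),
      (∑ r ∈ s, f r) {i} = ∑ r ∈ s, f r {i} := by
    intro s f
    induction s using Finset.induction_on with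
    | empty => simp
    | insert a s ha ih => rw [Finset.sum_insert ha, Finset.sum_insert ha, ← ih]; rfl
  rw [poissonCharlier, hsum]
  refine Finset.sum_congr rfl fun r _ => ?_
  rw [smul_apply, hsum, smul_eq_mul]
  congr 1

/-- A Poisson–Charlier signed measure is concentrated on the nonnegative integers. -/
theorem poissonCharlier_of_neg (lam : ℝ≥0) (H : ℝ[X]) (i : ℤ) (hi : i < 0) :
    poissonCharlier lam H {i} = 0 := by
  rw [poissonCharlier_singleton]
  refine Finset.sum_eq_zero fun r _ => ?_
  rw [Finset.sum_eq_zero, mul_zero]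
  intro k _
  rw [poissonShift_singleton, if_neg (by omega), mul_zero]

/-- The characteristic function of the Poisson–Charlier signed measure is
`exp(lam (e^{it} - 1)) H(e^{it} - 1)`. -/
theorem hasSum_poissonCharlier (lam : ℝ≥0) (H : ℝ[X]) (t : ℝ) :
    HasSum (fun i : ℤ => ((poissonCharlier lam H {i} : ℝ) : ℂ) * Complex.exp (Complex.I * t * i))
      (Complex.exp (lam * (Complex.exp (Complex.I * t) - 1))
        * aeval (Complex.exp (Complex.I * t) - 1) H) := by
  have h : HasSum (fun i : ℤ => ∑ r ∈ Finset.range (H.natDegree + 1), (H.coeff r : ℂ) *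
      ∑ k ∈ Finset.range (r + 1), ((-1 : ℂ) ^ (r - k) * (r.choose k : ℂ)) *
        (((poissonShift lam k {i} : ℝ) : ℂ) * Complex.exp (Complex.I * t * i)))
      (∑ r ∈ Finset.range (H.natDegree + 1), (H.coeff r : ℂ) *
      ∑ k ∈ Finset.range (r + 1), ((-1 : ℂ) ^ (r - k) * (r.choose k : ℂ)) *
        (Complex.exp (lam * (Complex.exp (Complex.I * t) - 1))
          * Complex.exp (Complex.I * t) ^ k)) :=
    hasSum_sum fun r _ => (hasSum_sum fun k _ => (hasSum_poissonShift lam k t).mul_left _).mul_left _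
  convert! h using 1
  · ext i
    rw [poissonCharlier_singleton]
    push_cast
    rw [Finset.sum_mul]
    refine Finset.sum_congr rfl fun r _ => ?_
    rw [mul_assoc, Finset.sum_mul]
    congr 1
    exact Finset.sum_congr rfl fun k _ => by ring
  · rw [aeval_eq_sum_range, Finset.mul_sum]
    refine Finset.sum_congr rfl fun r _ => ?_
    rw [sub_eq_add_neg, add_pow, Complex.real_smul, Finset.mul_sum, Finset.mul_sum, Finset.mul_sum]
    exact Finset.sum_congr rfl fun k _ => by ring

/-- The point masses of the Poisson–Charlier signed measure in terms of the Charlier polynomials. -/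
theorem poissonCharlier_natCast (lam : ℝ≥0) (hlam : 0 < lam) (H : ℝ[X]) (j : ℕ) :
    poissonCharlier lam H {(j : ℤ)} = (poissonMeasure lam).real {j} *
      ∑ r ∈ Finset.range (H.natDegree + 1), (-1 : ℝ) ^ r * H.coeff r * charlier r j lam := by
  have hl : (lam : ℝ) ≠ 0 := by exact_mod_cast hlam.ne'
  rw [poissonCharlier_singleton, Finset.mul_sum]
  refine Finset.sum_congr rfl fun r _ => ?_
  rw [charlier, Finset.mul_sum, Finset.mul_sum, Finset.mul_sum]
  refine Finset.sum_congr rfl fun k hk => ?_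
  have hkr : k ≤ r := by simpa [Nat.lt_succ_iff] using hk
  have hsign : (-1 : ℝ) ^ (r - k) = (-1) ^ r * (-1) ^ k := by
    obtain ⟨d, rfl⟩ := Nat.exists_eq_add_of_le hkr
    rw [Nat.add_sub_cancel_left, pow_add, mul_assoc, mul_comm ((-1 : ℝ) ^ d), ← mul_assoc,
      ← mul_pow]
    simp
  have hP : poissonShift lam k {(j : ℤ)} = (poissonMeasure lam).real {j} *
      ((j.choose k : ℝ) * (k.factorial : ℝ) * ((lam : ℝ) ^ k)⁻¹) := by
    rw [poissonShift_singleton]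
    split_ifs with h
    · have hkj : k ≤ j := by exact_mod_cast h
      obtain ⟨d, rfl⟩ := Nat.exists_eq_add_of_le hkj
      have h1 : (((k + d : ℕ) : ℤ) - k).toNat = d := by omega
      have h2 : ((k + d).choose k : ℝ) * (k.factorial : ℝ) * (d.factorial : ℝ)
          = ((k + d).factorial : ℝ) := by
        have h6 := Nat.choose_mul_factorial_mul_factorial (Nat.le_add_right k d)
        rw [Nat.add_sub_cancel_left] at h6
        exact_mod_cast h6
      rw [h1, poissonMeasure_real_singleton, poissonMeasure_real_singleton, ← h2, pow_add]
      have h3 : ((k + d).choose k : ℝ) ≠ 0 := by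
        exact_mod_cast (Nat.choose_pos (Nat.le_add_right k d)).ne'
      have h4 : (k.factorial : ℝ) ≠ 0 := by exact_mod_cast k.factorial_ne_zero
      have h5 : (d.factorial : ℝ) ≠ 0 := by exact_mod_cast d.factorial_ne_zero
      field_simp
    · have hjk : j < k := by
        by_contra h'
        exact h (by omega)
      rw [Nat.choose_eq_zero_of_lt hjk]
      simp
  rw [hP, hsign]
  ring

/-- `ν_R`: the Poisson–Charlier signed measure with characteristic function
`exp(sigmaSq (e^{it} - 1)) H_R(e^{it} - 1)`, where `sigmaSq` stands for the variance `σ_n²`. -/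
noncomputable def nuR (R n m : ℕ) (sigmaSq : ℝ) : SignedMeasure ℤ :=
  poissonCharlier sigmaSq.toNNReal (HPoly R n m)

end CouponCollector

/-! While i coupons are known, the next new one needs a geometric number of draws with failure
probability i/n. With D = n - m - 1, the shifted waiting time is therefore a sum of independent
geometric variables with odds x_i = i/(n - i), i = 0, ..., D. With w = e^{it} - 1 its characteristic
function is ∏ (1 - x_i w)⁻¹. The power sums of the x_i are the a_{n,r}; the mean is a_1 and the
variance is v = a_1 + a_2. Hence c = ⌊a_2⌋ = 0 under the hypothesis a_2 < 1.

The logarithm of the product is ∑ a_r w^r / r. Taking out v w, the exponent of a Poisson law with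
the right variance, leaves h_R(w) up to O(a_{R+1} |w|^{R+1}). Since h_R(w) = O(a_2 |w|), replacing
exp(h_R) by its first L = 3R - 1 terms costs O((a_2 |w|)^L). Both errors carry the factor |e^{v w}|
= e^{v (cos t - 1)} (`exists_norm_prod_sub_le`).

Fourier inversion (`norm_coeff_le_of_hasSum`) bounds every point mass difference by the integral of
this error, and the Gaussian decay of the factor turns |w|^j into s^{-(j+1)} whenever s² ≤ v
(`exists_integral_exp_mul_cos_le`). Here s = D/(2√n) is admissible, because a_1 ≥ D²/(4n). With
a_{R+1} ≤ D (2D/n)^{R+1} all powers of D cancel in the first error, which leaves n^{-R/2}. In the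
second, a_2 ≤ 4D³/n², and a_2 < 1 forces D³ ≤ 3n²; the choice L = 3R - 1 makes this exactly n^{-R/2}
again.

The law itself comes from the Markov recursion for the number of distinct coupons seen, which is the
recursion defining a convolution with a geometric law (`measure_card_seen_eq`). -/

namespace CouponCollector

/-! ### Convolution with geometric distributions -/

/-- The convolution of the sequence `a` with the geometric distribution `(1 - q) q ^ s` on `ℕ`. -/
noncomputable def geomConv (q : ℝ) (a : ℕ → ℝ) : ℕ → ℝ
  | 0 => (1 - q) * a 0
  | s + 1 => q * geomConv q a s + (1 - q) * a (s + 1)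

/-- The sequence is bounded by a convergent geometric sequence. -/
def HasGeomDecay (a : ℕ → ℝ) : Prop :=
  ∃ C r : ℝ, 0 ≤ C ∧ 0 < r ∧ r < 1 ∧ ∀ s, |a s| ≤ C * r ^ s

theorem geomConv_nonneg {q : ℝ} {a : ℕ → ℝ} (hq0 : 0 ≤ q) (hq1 : q < 1) (ha : ∀ s, 0 ≤ a s)
    (s : ℕ) : 0 ≤ geomConv q a s := by
  have h1 : 0 ≤ 1 - q := by linarith
  induction s with
  | zero => exact mul_nonneg h1 (ha 0)
  | succ s ih => exact add_nonneg (mul_nonneg hq0 ih) (mul_nonneg h1 (ha _))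

/-- Any rate r' strictly between max(r, q) and 1 works. The constant K = C/(r' - q) is chosen so
that the bound K r'^s reproduces itself under the recursion. -/
theorem HasGeomDecay.geomConv {q : ℝ} {a : ℕ → ℝ} (hq0 : 0 ≤ q) (hq1 : q < 1)
    (ha : HasGeomDecay a) : HasGeomDecay (geomConv q a) := by
  obtain ⟨C, r, hC, hr0, hr1, h⟩ := ha
  obtain ⟨r', hr', hr'1⟩ := exists_between (max_lt hr1 hq1)
  have hrr : r ≤ r' := ((le_max_left r q).trans_lt hr').le
  have hqr : q < r' := (le_max_right r q).trans_lt hr'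
  have hr'0 : 0 < r' := hr0.trans_le hrr
  have h' : ∀ s, |a s| ≤ C * r' ^ s := fun s => (h s).trans (by gcongr)
  have hd : 0 < r' - q := by linarith
  have h1q : 0 ≤ 1 - q := by linarith
  refine ⟨C / (r' - q), r', by positivity, hr'0, hr'1, fun s => ?_⟩
  have hC' : C / (r' - q) * (r' - q) = C := div_mul_cancel₀ _ hd.ne'
  have hCK : 0 ≤ C / (r' - q) := by positivity
  set K := C / (r' - q)
  induction s with
  | zero =>
    rw [CouponCollector.geomConv, abs_mul, abs_of_nonneg h1q, pow_zero, mul_one]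
    have := h' 0
    rw [pow_zero, mul_one] at this
    calc (1 - q) * |a 0| ≤ (1 - q) * C := by gcongr
      _ = (1 - q) * (r' - q) * K := by rw [← hC']; ring
      _ ≤ 1 * 1 * K := by gcongr <;> linarith
      _ = K := by ring
  | succ s ih =>
    rw [CouponCollector.geomConv]
    calc |q * CouponCollector.geomConv q a s + (1 - q) * a (s + 1)|
        ≤ q * |CouponCollector.geomConv q a s| + (1 - q) * |a (s + 1)| := by
          refine (abs_add_le _ _).trans_eq ?_
          rw [abs_mul, abs_mul, abs_of_nonneg hq0, abs_of_nonneg h1q]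
      _ ≤ q * (K * r' ^ s) + (1 - q) * (C * r' ^ (s + 1)) := by
          gcongr
          exact h' _
      _ = K * r' ^ s * (q + (1 - q) * (r' - q) * r') := by rw [← hC']; ring
      _ ≤ K * r' ^ s * r' := by
          refine mul_le_mul_of_nonneg_left ?_ (by positivity)
          -- The difference of the two sides is (r' - q)(1 - (1 - q) r').
          nlinarith [mul_nonneg hd.le (by nlinarith : 0 ≤ 1 - (1 - q) * r')]
      _ = K * r' ^ (s + 1) := by ring

theorem HasGeomDecay.summable {E : Type*} [NormedAddCommGroup E] [NormedSpace ℝ E]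
    [CompleteSpace E] {a : ℕ → ℝ} (ha : HasGeomDecay a) {f : ℕ → E} (k : ℕ) (c : ℝ)
    (hf : ∀ s, ‖f s‖ ≤ c * ((s : ℝ) + 1) ^ k) : Summable fun s => a s • f s := by
  obtain ⟨C, r, hC, hr0, hr1, h⟩ := ha
  have hs : Summable fun s : ℕ => ((s + 1 : ℕ) : ℝ) ^ k * r ^ (s + 1) :=
    (summable_nat_add_iff 1).2 (summable_pow_mul_geometric_of_norm_lt_one k (r := r)
      (by rw [Real.norm_of_nonneg hr0.le]; exact hr1))
  refine Summable.of_norm_bounded (hs.mul_left (C * c / r)) fun s => ?_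
  rw [norm_smul, Real.norm_eq_abs]
  calc |a s| * ‖f s‖ ≤ (C * r ^ s) * (c * ((s : ℝ) + 1) ^ k) :=
        mul_le_mul (h s) (hf s) (norm_nonneg _) (by positivity)
    _ = C * c / r * (((s + 1 : ℕ) : ℝ) ^ k * r ^ (s + 1)) := by
        push_cast
        field_simp
        ring

/-- Summing the defining recursion against f gives a functional equation relating f and its shift.
The choices f = 1, s, s², z^s turn it into linear equations for the mass, the first two moments and
the generating function. -/
theorem tsum_geomConv_smul {E : Type*} [NormedAddCommGroup E] [NormedSpace ℝ E]
    {q : ℝ} {a : ℕ → ℝ} {f : ℕ → E} (h1 : Summable fun s => a s • f s)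
    (h2 : Summable fun s => geomConv q a s • f s)
    (h3 : Summable fun s => geomConv q a s • f (s + 1)) :
    ∑' s, geomConv q a s • f s
      = (1 - q) • ∑' s, a s • f s + q • ∑' s, geomConv q a s • f (s + 1) := by
  have h1' : Summable fun s => a (s + 1) • f (s + 1) :=
    (summable_nat_add_iff (f := fun s => a s • f s) 1).2 h1
  rw [h2.tsum_eq_zero_add, h1.tsum_eq_zero_add, smul_add, add_assoc, ← h1'.tsum_const_smul,
    ← h3.tsum_const_smul, ← (h1'.const_smul _).tsum_add (h3.const_smul _)]
  congr 1
  · rw [geomConv, mul_smul]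
  · congr 1
    ext s
    rw [geomConv, add_smul, mul_smul, mul_smul, add_comm]

/-! ### Moments and generating function of a geometric convolution -/

section Moments

variable {q : ℝ} {a : ℕ → ℝ}

theorem tsum_geomConv (hq0 : 0 ≤ q) (hq1 : q < 1) (ha : HasGeomDecay a) :
    ∑' s, geomConv q a s = ∑' s, a s := by
  have hb : HasGeomDecay (geomConv q a) := ha.geomConv hq0 hq1
  have hone : ∀ s : ℕ, ‖(1 : ℝ)‖ ≤ 1 * ((s : ℝ) + 1) ^ 0 := by simp
  have h := tsum_geomConv_smul (q := q) (ha.summable 0 1 hone) (hb.summable 0 1 hone)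
    (hb.summable 0 1 hone)
  simp only [smul_eq_mul, mul_one] at h
  have : (1 - q) * (∑' s, geomConv q a s - ∑' s, a s) = 0 := by linarith
  rcases mul_eq_zero.1 this with h | h <;> linarith

theorem tsum_geomConv_mul_natCast (hq0 : 0 ≤ q) (hq1 : q < 1) (ha : HasGeomDecay a)
    (ha1 : ∑' s, a s = 1) :
    ∑' s, geomConv q a s * (s : ℝ) = ∑' s, a s * (s : ℝ) + q / (1 - q) := by
  have hb : HasGeomDecay (geomConv q a) := ha.geomConv hq0 hq1
  have hone : ∀ s : ℕ, ‖(1 : ℝ)‖ ≤ 1 * ((s : ℝ) + 1) ^ 0 := by simp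
  have hid : ∀ s : ℕ, ‖(s : ℝ)‖ ≤ 1 * ((s : ℝ) + 1) ^ 1 := by simp
  have hid' : ∀ s : ℕ, ‖((s + 1 : ℕ) : ℝ)‖ ≤ 1 * ((s : ℝ) + 1) ^ 1 := fun s => by
    rw [Real.norm_natCast]; simp
  have h := tsum_geomConv_smul (q := q) (ha.summable 1 1 hid) (hb.summable 1 1 hid)
    (hb.summable 1 1 hid')
  have hs1 := hb.summable 0 1 hone
  have hs2 := hb.summable 1 1 hid
  have h1 := tsum_geomConv hq0 hq1 ha
  simp only [smul_eq_mul, mul_one, Nat.cast_add, Nat.cast_one, mul_add] at h hs1 hs2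
  rw [hs2.tsum_add hs1, h1, ha1] at h
  have : 1 - q ≠ 0 := by linarith
  field_simp
  linarith

theorem tsum_geomConv_mul_sq (hq0 : 0 ≤ q) (hq1 : q < 1) (ha : HasGeomDecay a)
    (ha1 : ∑' s, a s = 1) :
    ∑' s, geomConv q a s * (s : ℝ) ^ 2 = ∑' s, a s * (s : ℝ) ^ 2
      + q / (1 - q) * (2 * (∑' s, a s * (s : ℝ) + q / (1 - q)) + 1) := by
  have hb : HasGeomDecay (geomConv q a) := ha.geomConv hq0 hq1
  have hone : ∀ s : ℕ, ‖(1 : ℝ)‖ ≤ 1 * ((s : ℝ) + 1) ^ 0 := by simp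
  have hid : ∀ s : ℕ, ‖(s : ℝ)‖ ≤ 1 * ((s : ℝ) + 1) ^ 1 := by simp
  have hsq : ∀ s : ℕ, ‖(s : ℝ) ^ 2‖ ≤ 1 * ((s : ℝ) + 1) ^ 2 := fun s => by
    rw [Real.norm_of_nonneg (by positivity), one_mul]
    gcongr
    linarith
  have hsq' : ∀ s : ℕ, ‖((s + 1 : ℕ) : ℝ) ^ 2‖ ≤ 1 * ((s : ℝ) + 1) ^ 2 := fun s => by
    rw [Real.norm_of_nonneg (by positivity), one_mul]
    push_cast
    rfl
  have h := tsum_geomConv_smul (q := q) (ha.summable 2 1 hsq) (hb.summable 2 1 hsq)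
    (hb.summable 2 1 hsq')
  have hs1 := hb.summable 0 1 hone
  have hs2 := (hb.summable 1 1 hid).mul_left 2
  have hs3 := hb.summable 2 1 hsq
  have h1 := tsum_geomConv hq0 hq1 ha
  have h2 := tsum_geomConv_mul_natCast hq0 hq1 ha ha1
  have he : ∀ s : ℕ, geomConv q a s * ((s + 1 : ℕ) : ℝ) ^ 2 = geomConv q a s * (s : ℝ) ^ 2
      + (2 * (geomConv q a s * (s : ℝ)) + geomConv q a s) := fun s => by push_cast; ring
  simp only [smul_eq_mul, mul_one, he] at h hs1 hs2 hs3
  rw [hs3.tsum_add (hs2.add hs1), hs2.tsum_add hs1, tsum_mul_left, h1, ha1, h2] at h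
  have h1q : 1 - q ≠ 0 := by linarith
  have h5 : (1 - q) * ∑' s, geomConv q a s * (s : ℝ) ^ 2 = (1 - q) * (∑' s, a s * (s : ℝ) ^ 2
      + q / (1 - q) * (2 * (∑' s, a s * (s : ℝ) + q / (1 - q)) + 1)) := by
    rw [mul_add (1 - q), ← mul_assoc (1 - q) (q / (1 - q)), mul_div_cancel₀ _ h1q]
    linarith
  exact mul_left_cancel₀ h1q h5

theorem tsum_geomConv_mul_pow (hq0 : 0 ≤ q) (hq1 : q < 1) (ha : HasGeomDecay a)
    {z : ℂ} (hz : ‖z‖ ≤ 1) :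
    ∑' s, (geomConv q a s : ℂ) * z ^ s
      = (∑' s, (a s : ℂ) * z ^ s) * (1 - (q / (1 - q) : ℝ) * (z - 1))⁻¹ := by
  have hb : HasGeomDecay (geomConv q a) := ha.geomConv hq0 hq1
  have hz1 : ∀ s : ℕ, ‖z ^ s‖ ≤ 1 * ((s : ℝ) + 1) ^ 0 := fun s => by
    rw [norm_pow, pow_zero, mul_one]
    exact pow_le_one₀ (norm_nonneg _) hz
  have h := tsum_geomConv_smul (q := q) (ha.summable 0 1 hz1) (hb.summable 0 1 hz1)
    (hb.summable 0 1 fun s => (hz1 (s + 1)).trans (by simp))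
  simp only [Complex.real_smul, pow_succ, ← mul_assoc] at h
  rw [tsum_mul_right] at h
  have h1q : (1 - q : ℂ) ≠ 0 := by
    have : (1 - q : ℝ) ≠ 0 := by linarith
    exact_mod_cast this
  have hqz : (1 - q * z : ℂ) ≠ 0 := by
    intro h0
    have h2 : ‖(q * z : ℂ)‖ = 1 := by rw [← sub_eq_zero.1 h0, norm_one]
    rw [norm_mul, Complex.norm_real, Real.norm_of_nonneg hq0] at h2
    nlinarith [norm_nonneg z]
  -- Passing from the failure probability q to the odds q/(1 - q) makes the factor a function of z -
  -- 1, the variable of the expansion.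
  have hk : (1 - (q / (1 - q) : ℝ) * (z - 1) : ℂ) = (1 - q * z) / (1 - q) := by
    push_cast
    field_simp
    ring
  rw [hk, inv_div, ← mul_div_assoc, eq_div_iff hqz]
  push_cast at h
  linear_combination h

end Moments

/-! ### The law of the excess, its moments and its generating function -/

/-- The distribution of the excess over `j + 1` of the number of draws that show `j + 1` distinct
coupons out of `n`: a sum of independent geometric variables. -/
noncomputable def excessLaw (n : ℕ) : ℕ → ℕ → ℝ
  | 0 => Pi.single 0 1
  | j + 1 => geomConv ((j + 1 : ℕ) / n) (excessLaw n j)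

/-- `∑_{i ≤ j} (i / (n - i))^r`. -/
noncomputable def oddsSum (n j r : ℕ) : ℝ :=
  ∑ i ∈ Finset.range (j + 1), ((i : ℝ) / ((n : ℝ) - i)) ^ r

theorem hasGeomDecay_excessLaw {n j : ℕ} (hj : j < n) : HasGeomDecay (excessLaw n j) := by
  induction j with
  | zero =>
    refine ⟨1, 1 / 2, by norm_num, by norm_num, by norm_num, fun s => ?_⟩
    rcases eq_or_ne s 0 with rfl | hs
    · simp [excessLaw]
    · simp only [excessLaw, Pi.single_eq_of_ne hs, abs_zero]
      positivity
  | succ j ih =>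
    have hn : (0 : ℝ) < n := by exact_mod_cast (by omega : 0 < n)
    refine (ih (by omega)).geomConv (by positivity) ?_
    rw [div_lt_one hn]
    exact_mod_cast hj

theorem excessLaw_nonneg {n j : ℕ} (hj : j < n) (s : ℕ) : 0 ≤ excessLaw n j s := by
  induction j generalizing s with
  | zero =>
    rcases eq_or_ne s 0 with rfl | hs
    · simp [excessLaw]
    · simp [excessLaw, Pi.single_eq_of_ne hs]
  | succ j ih =>
    have hn : (0 : ℝ) < n := by exact_mod_cast (by omega : 0 < n)
    refine geomConv_nonneg (by positivity) ?_ (ih (by omega)) s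
    rw [div_lt_one hn]
    exact_mod_cast hj

theorem tsum_excessLaw_zero_mul {𝕜 : Type*} [RCLike 𝕜] (n : ℕ) (f : ℕ → 𝕜) :
    ∑' s, (excessLaw n 0 s : 𝕜) * f s = f 0 := by
  rw [tsum_eq_single 0]
  · simp [excessLaw]
  · intro s hs
    simp [excessLaw, Pi.single_eq_of_ne hs]

theorem natCast_div_mem_Ico {n j : ℕ} (hj : j < n) :
    (0 : ℝ) ≤ (j : ℝ) / n ∧ (j : ℝ) / n < 1 ∧
      (j : ℝ) / n / (1 - (j : ℝ) / n) = (j : ℝ) / ((n : ℝ) - j) := by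
  have hn : (0 : ℝ) < n := by exact_mod_cast (by omega : 0 < n)
  have hjn : (j : ℝ) < n := by exact_mod_cast hj
  refine ⟨by positivity, by rwa [div_lt_one hn], ?_⟩
  have : (n : ℝ) - j ≠ 0 := by linarith
  field_simp

theorem tsum_excessLaw {n j : ℕ} (hj : j < n) : ∑' s, excessLaw n j s = 1 := by
  induction j with
  | zero => simpa using tsum_excessLaw_zero_mul n (fun _ => (1 : ℝ))
  | succ j ih =>
    obtain ⟨h0, h1, -⟩ := natCast_div_mem_Ico hj
    exact (tsum_geomConv h0 h1 (hasGeomDecay_excessLaw (by omega))).trans (ih (by omega))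

theorem tsum_excessLaw_mul_natCast {n j : ℕ} (hj : j < n) :
    ∑' s, excessLaw n j s * (s : ℝ) = oddsSum n j 1 := by
  induction j with
  | zero => simpa [oddsSum] using tsum_excessLaw_zero_mul n (fun s => (s : ℝ))
  | succ j ih =>
    obtain ⟨h0, h1, h2⟩ := natCast_div_mem_Ico hj
    have hj' : j < n := by omega
    rw [oddsSum, Finset.sum_range_succ, pow_one, ← h2, ← oddsSum, ← ih hj']
    exact tsum_geomConv_mul_natCast h0 h1 (hasGeomDecay_excessLaw hj') (tsum_excessLaw hj')

theorem tsum_excessLaw_mul_sq {n j : ℕ} (hj : j < n) :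
    ∑' s, excessLaw n j s * (s : ℝ) ^ 2
      = oddsSum n j 1 + oddsSum n j 2 + oddsSum n j 1 ^ 2 := by
  induction j with
  | zero => simpa [oddsSum] using tsum_excessLaw_zero_mul (𝕜 := ℝ) n (fun s => (s : ℝ) ^ (2 : ℕ))
  | succ j ih =>
    obtain ⟨h0, h1, h2⟩ := natCast_div_mem_Ico hj
    have hj' : j < n := by omega
    have h := tsum_geomConv_mul_sq h0 h1 (hasGeomDecay_excessLaw hj') (tsum_excessLaw hj')
    rw [ih hj', tsum_excessLaw_mul_natCast hj', h2] at h
    refine h.trans ?_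
    have hs : ∀ r, oddsSum n (j + 1) r
        = oddsSum n j r + (((j + 1 : ℕ) : ℝ) / ((n : ℝ) - (j + 1 : ℕ))) ^ r := fun r => by
      rw [oddsSum, Finset.sum_range_succ, ← oddsSum]
    rw [hs, hs]
    ring

theorem tsum_excessLaw_mul_pow {n j : ℕ} (hj : j < n) {z : ℂ} (hz : ‖z‖ ≤ 1) :
    ∑' s, (excessLaw n j s : ℂ) * z ^ s
      = ∏ i ∈ Finset.range (j + 1), (1 - ((i : ℝ) / ((n : ℝ) - i) : ℝ) * (z - 1))⁻¹ := by
  induction j with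
  | zero => simpa using tsum_excessLaw_zero_mul n (fun s => z ^ s)
  | succ j ih =>
    obtain ⟨h0, h1, h2⟩ := natCast_div_mem_Ico hj
    have hj' : j < n := by omega
    rw [Finset.prod_range_succ, ← h2, ← ih hj']
    exact tsum_geomConv_mul_pow h0 h1 (hasGeomDecay_excessLaw hj') hz

theorem summable_excessLaw_smul {E : Type*} [NormedAddCommGroup E] [NormedSpace ℝ E]
    [CompleteSpace E] {n j : ℕ} (hj : j < n) {f : ℕ → E} (k : ℕ)
    (hf : ∀ s, ‖f s‖ ≤ ((s : ℝ) + 1) ^ k) : Summable fun s => excessLaw n j s • f s :=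
  (hasGeomDecay_excessLaw hj).summable k 1 fun s => by simpa using hf s

/-- Reflection k = n - i; the index i counts the coupons already collected. -/
theorem aSum_eq_oddsSum {n m : ℕ} (hm : m < n) (r : ℕ) :
    aSum n m r = oddsSum n (n - m - 1) r := by
  rw [aSum, oddsSum]
  refine Finset.sum_nbij' (fun k => n - k) (fun i => n - i) ?_ ?_ ?_ ?_ ?_
  · intro k hk
    rw [Finset.mem_Icc] at hk
    rw [Finset.mem_range]
    omega
  · intro i hi
    rw [Finset.mem_range] at hi
    rw [Finset.mem_Icc]
    omega
  · intro k hk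
    rw [Finset.mem_Icc] at hk
    omega
  · intro i hi
    rw [Finset.mem_range] at hi
    omega
  · intro k hk
    rw [Finset.mem_Icc] at hk
    rw [Nat.cast_sub hk.2, sub_sub_cancel]

/-! ### The coupons seen and the waiting time, path by path -/

section Draws

variable {Ω : Type*} {n : ℕ}

/-- The set of the coupons shown by the first `t` draws. -/
def seen (X : ℕ → Ω → Fin n) (t : ℕ) (ω : Ω) : Finset (Fin n) :=
  (Finset.range t).image fun i => X i ω

theorem seen_succ (X : ℕ → Ω → Fin n) (t : ℕ) (ω : Ω) :
    seen X (t + 1) ω = insert (X t ω) (seen X t ω) := by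
  rw [seen, Finset.range_add_one, Finset.image_insert, seen]

theorem seen_mono (X : ℕ → Ω → Fin n) (ω : Ω) : Monotone fun t => seen X t ω :=
  fun _ _ h => Finset.image_subset_image (Finset.range_mono h)

theorem card_seen_le (X : ℕ → Ω → Fin n) (t : ℕ) (ω : Ω) : (seen X t ω).card ≤ t :=
  Finset.card_image_le.trans_eq (Finset.card_range t)

theorem waitingTime_eq_succ_iff (X : ℕ → Ω → Fin n) {m j : ℕ} (hj : n - m = j + 1) (ω : Ω)
    (t : ℕ) :
    waitingTime X m ω = t + 1 ↔ (seen X t ω).card = j ∧ X t ω ∉ seen X t ω := by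
  have hmono : ∀ k, (seen X k ω).card ≤ (seen X (k + 1) ω).card := fun k =>
    Finset.card_le_card (seen_mono X ω k.le_succ)
  have hset : waitingTime X m ω = sInf {t | j + 1 ≤ (seen X t ω).card} := by
    rw [← hj]
    rfl
  have hiff : waitingTime X m ω = t + 1 ↔
      j + 1 ≤ (seen X (t + 1) ω).card ∧ ¬ j + 1 ≤ (seen X t ω).card := by
    rw [hset, Nat.sInf_upward_closed_eq_succ_iff]
    · rfl
    · intro k₁ k₂ hk h
      exact le_trans h (Finset.card_le_card (seen_mono X ω hk))
  rw [hiff, seen_succ]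
  by_cases hX : X t ω ∈ seen X t ω
  · rw [Finset.insert_eq_of_mem hX]
    simp only [hX, not_true_eq_false, and_false, iff_false]
    omega
  · rw [Finset.card_insert_of_notMem hX]
    simp only [hX, not_false_eq_true, and_true]
    omega

end Draws

/-! ### The law of the waiting time -/

section Law

variable {Ω : Type*} [MeasurableSpace Ω] {n : ℕ} {X : ℕ → Ω → Fin n} {P : Measure Ω}

theorem IsUniformSampling.measurableSet_seen (hX : IsUniformSampling X P) (t : ℕ)
    (p : Finset (Fin n) → Prop) : MeasurableSet {ω | p (seen X t ω)} := by
  have h : Measurable fun ω (i : Finset.range t) => X i ω :=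
    measurable_pi_iff.2 fun i => hX.measurable i
  have : {ω | p (seen X t ω)} = (fun ω (i : Finset.range t) => X i ω) ⁻¹'
      {x | p ((Finset.univ : Finset (Finset.range t)).image x)} := by
    ext ω
    have : seen X t ω
        = (Finset.univ : Finset (Finset.range t)).image fun i : Finset.range t => X i ω := by
      ext c
      simp [seen]
    simp only [Set.mem_ofPred_eq, Set.mem_preimage, this]
  rw [this]
  exact h (Set.toFinite _).measurableSet

/-- The set seen is a function of the draws with index below t, which are independent of draw t. -/
theorem IsUniformSampling.measure_seen_inter (hX : IsUniformSampling X P) (t : ℕ)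
    (s : Finset (Fin n)) (c : Fin n) :
    P.real ({ω | seen X t ω = s} ∩ {ω | X t ω = c}) = P.real {ω | seen X t ω = s} / n := by
  have hind := hX.indep.indepFun_finset (Finset.range t) {t} (by simp) hX.measurable
  have h1 : {ω | seen X t ω = s} = (fun ω (i : Finset.range t) => X i ω) ⁻¹'
      {x | (Finset.univ : Finset (Finset.range t)).image x = s} := by
    ext ω
    have : seen X t ω
        = (Finset.univ : Finset (Finset.range t)).image fun i : Finset.range t => X i ω := by
      ext c
      simp [seen]
    simp only [Set.mem_ofPred_eq, Set.mem_preimage, this]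
  have h2 : {ω | X t ω = c} = (fun ω (i : ({t} : Finset ℕ)) => X i ω) ⁻¹'
      {x | x ⟨t, Finset.mem_singleton_self t⟩ = c} := rfl
  have h3 := hind.measure_inter_preimage_eq_mul _ _
    (Set.toFinite {x | (Finset.univ : Finset (Finset.range t)).image x = s}).measurableSet
    (Set.toFinite {x | x ⟨t, Finset.mem_singleton_self t⟩ = c}).measurableSet
  rw [← h1, ← h2] at h3
  have h4 := hX.uniform t c
  rw [measureReal_def, h3, ENNReal.toReal_mul, ← measureReal_def, ← measureReal_def]
  change _ * P.real (X t ⁻¹' {c}) = _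
  rw [h4, mul_one_div]

theorem IsUniformSampling.measurable_waitingTime (hX : IsUniformSampling X P) {m : ℕ}
    (hm : m < n) : Measurable (waitingTime X m) := by
  have hsucc : ∀ t, MeasurableSet (waitingTime X m ⁻¹' {t + 1}) := by
    intro t
    have : waitingTime X m ⁻¹' {t + 1} = ⋃ c : Fin n,
        {ω | (seen X t ω).card = n - m - 1 ∧ c ∉ seen X t ω} ∩ X t ⁻¹' {c} := by
      ext ω
      simp only [Set.mem_preimage, Set.mem_singleton_iff, Set.mem_iUnion, Set.mem_inter_iff,
        Set.mem_ofPred_eq]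
      rw [waitingTime_eq_succ_iff X (by omega : n - m = n - m - 1 + 1)]
      simp
    rw [this]
    exact MeasurableSet.iUnion fun c => (hX.measurableSet_seen t
      (fun s => s.card = n - m - 1 ∧ c ∉ s)).inter (hX.measurable t (MeasurableSet.singleton c))
  refine measurable_to_countable' fun t => ?_
  rcases t with _ | t
  -- Since n - m > 0, the value 0 occurs only as the default of `sInf ∅`, when the coupons never
  -- suffice. It is handled as the complement of the positive values.
  · have : waitingTime X m ⁻¹' {0} = (⋃ t, waitingTime X m ⁻¹' {t + 1})ᶜ := by
      ext ω
      simp only [Set.mem_preimage, Set.mem_singleton_iff, Set.mem_compl_iff, Set.mem_iUnion,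
        not_exists]
      exact ⟨fun h t ht => by omega, fun h => by
        by_contra h0
        exact h _ (Nat.succ_pred_eq_of_ne_zero h0).symm⟩
    rw [this]
    exact (MeasurableSet.iUnion hsucc).compl
  · exact hsucc t

theorem IsUniformSampling.measurable_shiftedTime (hX : IsUniformSampling X P) {m : ℕ}
    (hm : m < n) : Measurable (shiftedTime X m) := by
  have h : Measurable fun k : ℕ => (k : ℤ) - ((n : ℤ) - (m : ℤ)) := measurable_of_countable _
  exact h.comp (hX.measurable_waitingTime hm)

variable [IsProbabilityMeasure P]

/-- Conditionally on the coupons shown by the first `t` draws, the probability that the next draw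
falls into a set depending on them is proportional to the size of this set. -/
theorem IsUniformSampling.measure_seen_mem (hX : IsUniformSampling X P) (t k l : ℕ)
    (T : Finset (Fin n) → Finset (Fin n)) (hT : ∀ s, s.card = k → (T s).card = l) :
    P.real {ω | (seen X t ω).card = k ∧ X t ω ∈ T (seen X t ω)}
      = (l : ℝ) / n * P.real {ω | (seen X t ω).card = k} := by
  have hXm : ∀ c, MeasurableSet {ω | X t ω = c} := fun c =>
    hX.measurable t (MeasurableSet.singleton c)
  have hSm : ∀ s, MeasurableSet {ω | seen X t ω = s} := fun s =>
    hX.measurableSet_seen t (· = s)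
  have h1 : {ω | (seen X t ω).card = k ∧ X t ω ∈ T (seen X t ω)}
      = ⋃ x ∈ (Finset.univ.filter fun s : Finset (Fin n) => s.card = k).sigma T,
        ({ω | seen X t ω = x.1} ∩ {ω | X t ω = x.2}) := by
    ext ω
    simp only [Set.mem_ofPred_eq, Set.mem_iUnion, Finset.mem_sigma, Finset.mem_filter,
      Finset.mem_univ, true_and, Set.mem_inter_iff, exists_prop]
    constructor
    · rintro ⟨h, h'⟩
      exact ⟨⟨seen X t ω, X t ω⟩, ⟨h, h'⟩, rfl, rfl⟩
    · rintro ⟨⟨s, c⟩, ⟨h, h'⟩, rfl, rfl⟩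
      exact ⟨h, h'⟩
  have h2 : {ω | (seen X t ω).card = k}
      = ⋃ s ∈ (Finset.univ.filter fun s : Finset (Fin n) => s.card = k),
        {ω | seen X t ω = s} := by
    ext ω
    simp
  rw [h1, h2, measureReal_biUnion_finset, measureReal_biUnion_finset, Finset.sum_sigma,
    Finset.mul_sum]
  · refine Finset.sum_congr rfl fun s hs => ?_
    simp only [hX.measure_seen_inter, Finset.sum_const, nsmul_eq_mul]
    rw [hT s (by simpa using hs)]
    ring
  · intro s _ s' _ hne
    refine Set.disjoint_left.2 fun ω h h' => hne ?_
    exact h.symm.trans h'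
  · exact fun s _ => hSm s
  · rintro ⟨s, c⟩ _ ⟨s', c'⟩ _ hne
    refine Set.disjoint_left.2 fun ω h h' => hne ?_
    obtain ⟨rfl, rfl⟩ := h
    obtain ⟨rfl, rfl⟩ := h'
    rfl
  · exact fun x _ => (hSm x.1).inter (hXm x.2)

/-- One step of the Markov chain counting distinct coupons: it stays at j + 1 by repeating a seen
coupon, or arrives from j by drawing an unseen one. -/
theorem IsUniformSampling.measure_card_seen_succ (hX : IsUniformSampling X P) (t j : ℕ) :
    P.real {ω | (seen X (t + 1) ω).card = j + 1}
      = ((j + 1 : ℕ) : ℝ) / n * P.real {ω | (seen X t ω).card = j + 1}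
        + ((n - j : ℕ) : ℝ) / n * P.real {ω | (seen X t ω).card = j} := by
  have hXS : ∀ k, MeasurableSet {ω | (seen X t ω).card = k ∧ X t ω ∈ (seen X t ω)ᶜ} := by
    intro k
    have : {ω | (seen X t ω).card = k ∧ X t ω ∈ (seen X t ω)ᶜ} = ⋃ c : Fin n,
        {ω | (seen X t ω).card = k ∧ c ∈ (seen X t ω)ᶜ} ∩ X t ⁻¹' {c} := by
      ext ω
      simp
    rw [this]
    exact MeasurableSet.iUnion fun c => (hX.measurableSet_seen t
      (fun s => s.card = k ∧ c ∈ sᶜ)).inter (hX.measurable t (MeasurableSet.singleton c))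
  rw [← hX.measure_seen_mem t (j + 1) (j + 1) id (fun _ h => h),
    ← hX.measure_seen_mem t j (n - j) (fun s => sᶜ)
      (fun s h => by rw [Finset.card_compl, Fintype.card_fin, h]), ← measureReal_union _ (hXS j)]
  · congr 1
    ext ω
    simp only [Set.mem_ofPred_eq, Set.mem_union, id, Finset.mem_compl]
    rw [seen_succ]
    by_cases h : X t ω ∈ seen X t ω
    · simp [h]
    · rw [Finset.card_insert_of_notMem h]
      simp [h]
  · refine Set.disjoint_left.2 fun ω h h' => ?_
    exact absurd (h.1.symm.trans h'.1) (by omega)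

/-- The left side is the probability of having j coupons after s + j draws and then drawing a new
one. Multiplied by the probability of a new coupon, the Markov recursion becomes the recursion of
`geomConv` with q = (j + 1)/n; hence the induction on j with an inner one on s. -/
theorem IsUniformSampling.measure_card_seen_eq (hX : IsUniformSampling X P) {j : ℕ} (hj : j < n)
    (s : ℕ) :
    ((n - j : ℕ) : ℝ) / n * P.real {ω | (seen X (s + j) ω).card = j} = excessLaw n j s := by
  have hn : (n : ℝ) ≠ 0 := by exact_mod_cast (by omega : n ≠ 0)
  induction j generalizing s with
  | zero =>
    rw [Nat.sub_zero, div_self hn, one_mul, add_zero]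
    rcases s with _ | s
    · simp [seen, excessLaw]
    · have : {ω | (seen X (s + 1) ω).card = 0} = ∅ := by
        ext ω
        simp [seen]
      rw [this, measureReal_empty, excessLaw, Pi.single_eq_of_ne s.succ_ne_zero]
  | succ j ih =>
    have hp : (1 - ((j + 1 : ℕ) : ℝ) / n) = ((n - (j + 1) : ℕ) : ℝ) / n := by
      rw [Nat.cast_sub hj.le]
      field_simp
    rw [excessLaw]
    have hj' : j < n := by omega
    have hadd : ∀ a, a + (j + 1) = a + j + 1 := fun a => rfl
    induction s with
    | zero =>
      have h0 : {ω | (seen X (0 + j) ω).card = j + 1} = ∅ := by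
        ext ω
        have := card_seen_le X (0 + j) ω
        simp only [Set.mem_ofPred_eq, Set.mem_empty_iff_false, iff_false]
        omega
      rw [hadd, hX.measure_card_seen_succ, h0, measureReal_empty, mul_zero, zero_add,
        ih hj', geomConv, hp]
    | succ s ihs =>
      rw [hadd, hX.measure_card_seen_succ, ih hj', geomConv, hp, ← ihs]
      have : s + 1 + j = s + (j + 1) := by omega
      rw [this]
      ring

theorem IsUniformSampling.measure_waitingTime_eq (hX : IsUniformSampling X P) {m : ℕ}
    (hm : m < n) (s : ℕ) :
    P.real {ω | waitingTime X m ω = s + (n - m)} = excessLaw n (n - m - 1) s := by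
  have hj : n - m = n - m - 1 + 1 := by omega
  set j := n - m - 1
  have hjn : j < n := by omega
  rw [← hX.measure_card_seen_eq hjn, ← hX.measure_seen_mem (s + j) j (n - j) (fun s => sᶜ)
      (fun s h => by rw [Finset.card_compl, Fintype.card_fin, h])]
  congr 1
  ext ω
  simp only [Set.mem_ofPred_eq, Finset.mem_compl]
  rw [← waitingTime_eq_succ_iff X hj, hj, add_assoc]

/-- The law of `W_{n,m} - (n - m)`. -/
theorem IsUniformSampling.map_shiftedTime (hX : IsUniformSampling X P) {m : ℕ} (hm : m < n) :
    P.map (shiftedTime X m) = Measure.sum fun s : ℕ =>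
      ENNReal.ofReal (excessLaw n (n - m - 1) s) • Measure.dirac (s : ℤ) := by
  have hD : n - m - 1 < n := by omega
  have hmeas := hX.measurable_shiftedTime hm
  have : IsProbabilityMeasure (P.map (shiftedTime X m)) :=
    Measure.isProbabilityMeasure_map hmeas.aemeasurable
  set ν : Measure ℤ := Measure.sum fun s : ℕ =>
      ENNReal.ofReal (excessLaw n (n - m - 1) s) • Measure.dirac (s : ℤ) with hν
  have hsum : Summable fun s => excessLaw n (n - m - 1) s := by
    simpa using summable_excessLaw_smul hD (f := fun _ => (1 : ℝ)) 0 (by simp)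
  have hν1 : ν Set.univ = 1 := by
    rw [hν, Measure.sum_apply _ MeasurableSet.univ]
    simp only [Measure.smul_apply, measure_univ, smul_eq_mul, mul_one]
    rw [← ENNReal.ofReal_tsum_of_nonneg (excessLaw_nonneg hD) hsum, tsum_excessLaw hD,
      ENNReal.ofReal_one]
  -- One inequality suffices, since both measures have mass 1. This also shows, without a separate
  -- argument, that the waiting time is almost surely not a default value.
  have hle : ν ≤ P.map (shiftedTime X m) := by
    refine Measure.le_iff.2 fun A hA => ?_
    rw [← Measure.tsum_indicator_apply_singleton _ _ hA,
      ← Measure.tsum_indicator_apply_singleton _ _ hA]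
    refine ENNReal.tsum_le_tsum fun k => Set.indicator_le_indicator ?_
    rw [hν, Measure.sum_apply _ (MeasurableSet.singleton k)]
    simp only [Measure.smul_apply, smul_eq_mul, Measure.dirac_apply' _ (MeasurableSet.singleton k)]
    rcases lt_or_ge k 0 with hk | hk
    · refine le_of_eq_of_le ?_ zero_le
      rw [ENNReal.tsum_eq_zero]
      intro s
      rw [Set.indicator_of_notMem, mul_zero]
      simp only [Set.mem_singleton_iff]
      omega
    · lift k to ℕ using hk
      rw [tsum_eq_single k]
      · rw [Set.indicator_of_mem (by simp), Pi.one_apply, mul_one,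
          ← hX.measure_waitingTime_eq hm, ofReal_measureReal,
          Measure.map_apply hmeas (MeasurableSet.singleton _)]
        refine measure_mono fun ω hω => ?_
        simp only [Set.mem_ofPred_eq] at hω
        simp only [Set.mem_preimage, Set.mem_singleton_iff, shiftedTime, hω]
        omega
      · intro s hs
        rw [Set.indicator_of_notMem, mul_zero]
        simpa using hs
  have : IsFiniteMeasure ν := ⟨by rw [hν1]; exact ENNReal.one_lt_top⟩
  exact (Measure.eq_of_le_of_measure_univ_eq hle (by rw [hν1, measure_univ])).symm

theorem IsUniformSampling.integral_shiftedTime (hX : IsUniformSampling X P) {m : ℕ} (hm : m < n)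
    {E : Type*} [NormedAddCommGroup E] [NormedSpace ℝ E] [CompleteSpace E] (f : ℤ → E) (k : ℕ)
    (hf : ∀ s : ℕ, ‖f s‖ ≤ ((s : ℝ) + 1) ^ k) :
    Integrable (fun ω => f (shiftedTime X m ω)) P ∧
      HasSum (fun s : ℕ => excessLaw n (n - m - 1) s • f s) (∫ ω, f (shiftedTime X m ω) ∂P) := by
  have hD : n - m - 1 < n := by omega
  have hmeas := hX.measurable_shiftedTime hm
  have hlaw := hX.map_shiftedTime hm
  have hsm : ∀ μ : Measure ℤ, AEStronglyMeasurable f μ := fun μ =>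
    (StronglyMeasurable.of_discrete).aestronglyMeasurable
  have hS : Summable fun s : ℕ =>
      (ENNReal.ofReal (excessLaw n (n - m - 1) s)).toReal * ‖f s‖ := by
    simp only [ENNReal.toReal_ofReal (excessLaw_nonneg hD _)]
    exact summable_excessLaw_smul hD k (f := fun s : ℕ => ‖f s‖) (by simpa using hf)
  constructor
  · have := integrable_sum_dirac (x := fun s : ℕ => (s : ℤ)) (fun s => ENNReal.ofReal_ne_top) hS
    rw [← hlaw] at this
    exact (integrable_map_measure (hsm _) hmeas.aemeasurable).1 this
  · have := hasSum_integral_sum_dirac (x := fun s : ℕ => (s : ℤ))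
      (fun s => ENNReal.ofReal_ne_top) hS
    rw [← hlaw, integral_map hmeas.aemeasurable (hsm _)] at this
    simpa only [ENNReal.toReal_ofReal (excessLaw_nonneg hD _)] using this

theorem IsUniformSampling.mean_shiftedTime (hX : IsUniformSampling X P) {m : ℕ} (hm : m < n) :
    ∫ ω, (shiftedTime X m ω : ℝ) ∂P = aSum n m 1 := by
  have hD : n - m - 1 < n := by omega
  obtain ⟨-, h⟩ := hX.integral_shiftedTime hm (fun k : ℤ => (k : ℝ)) 1 (fun s => by simp)
  rw [← h.tsum_eq, aSum_eq_oddsSum hm, ← tsum_excessLaw_mul_natCast hD]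
  simp

theorem IsUniformSampling.variance_shiftedTime (hX : IsUniformSampling X P) {m : ℕ}
    (hm : m < n) :
    variance (fun ω => (shiftedTime X m ω : ℝ)) P = aSum n m 1 + aSum n m 2 := by
  have hD : n - m - 1 < n := by omega
  obtain ⟨hi, h⟩ := hX.integral_shiftedTime hm (fun k : ℤ => (k : ℝ) ^ 2) 2 (fun s => by
    rw [Real.norm_of_nonneg (by positivity), Int.cast_natCast]
    gcongr
    linarith)
  have hmeas : Measurable fun ω => (shiftedTime X m ω : ℝ) :=
    (measurable_of_countable fun k : ℤ => (k : ℝ)).comp (hX.measurable_shiftedTime hm)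
  have hL : MemLp (fun ω => (shiftedTime X m ω : ℝ)) 2 P :=
    (memLp_two_iff_integrable_sq hmeas.aestronglyMeasurable).2 hi
  rw [variance_eq_sub hL, hX.mean_shiftedTime hm]
  simp only [Pi.pow_apply]
  rw [← h.tsum_eq, aSum_eq_oddsSum hm, aSum_eq_oddsSum hm]
  have := tsum_excessLaw_mul_sq hD
  simp only [smul_eq_mul, Int.cast_natCast, this]
  ring

theorem IsUniformSampling.waitingVar_eq (hX : IsUniformSampling X P) {m : ℕ} (hm : m < n) :
    waitingVar X m P = aSum n m 1 + aSum n m 2 := by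
  have hmeas : Measurable fun ω => (waitingTime X m ω : ℝ) :=
    (measurable_of_countable fun k : ℕ => (k : ℝ)).comp (hX.measurable_waitingTime hm)
  rw [← hX.variance_shiftedTime hm, waitingVar,
    ← variance_sub_const hmeas.aestronglyMeasurable ((n : ℝ) - m)]
  congr 1
  ext ω
  simp [shiftedTime]

/-- Variance minus mean is exactly a_2, so its integer part vanishes and no shift takes place. -/
theorem IsUniformSampling.centering_eq_zero (hX : IsUniformSampling X P) {m : ℕ} (hm : m < n)
    (h0 : 0 ≤ aSum n m 2) (h1 : aSum n m 2 < 1) : centering X m P = 0 := by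
  rw [centering, hX.variance_shiftedTime hm, hX.mean_shiftedTime hm, add_sub_cancel_left,
    Int.floor_eq_zero_iff]
  exact ⟨h0, h1⟩

/-- The characteristic function of `W_{n,m} - (n - m)`. -/
theorem IsUniformSampling.hasSum_shiftedTime (hX : IsUniformSampling X P) {m : ℕ} (hm : m < n)
    (t : ℝ) :
    HasSum (fun i : ℤ => (((P.map (shiftedTime X m)).real {i} : ℝ) : ℂ)
        * Complex.exp (Complex.I * t * i))
      (∏ i ∈ Finset.range (n - m - 1 + 1), (1 - ((i : ℝ) / ((n : ℝ) - i) : ℝ)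
        * (Complex.exp (Complex.I * t) - 1))⁻¹) := by
  have hD : n - m - 1 < n := by omega
  have hmeas := hX.measurable_shiftedTime hm
  have hz : ‖Complex.exp (Complex.I * t)‖ = 1 := by
    rw [mul_comm, Complex.norm_exp_ofReal_mul_I]
  have hfn : ∀ k : ℤ, ‖Complex.exp (Complex.I * t * k)‖ = 1 := fun k => by
    have : Complex.I * t * k = ((t * k : ℝ) : ℂ) * Complex.I := by push_cast; ring
    rw [this, Complex.norm_exp_ofReal_mul_I]
  obtain ⟨-, h⟩ := hX.integral_shiftedTime hm (fun k : ℤ => Complex.exp (Complex.I * t * k)) 0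
    (fun s => by rw [hfn, pow_zero])
  have hpow : ∀ s : ℕ, Complex.exp (Complex.I * t * (s : ℤ)) = Complex.exp (Complex.I * t) ^ s :=
    fun s => by rw [← Complex.exp_nat_mul, Int.cast_natCast, mul_comm]
  have hreal : ∀ s : ℕ, (P.map (shiftedTime X m)).real {(s : ℤ)} = excessLaw n (n - m - 1) s := by
    intro s
    rw [← hX.measure_waitingTime_eq hm, map_measureReal_apply hmeas (MeasurableSet.singleton _)]
    congr 1
    ext ω
    simp only [Set.mem_preimage, Set.mem_singleton_iff, shiftedTime, Set.mem_ofPred_eq]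
    omega
  have hneg : ∀ k : ℤ, k ∉ Set.range (Nat.cast : ℕ → ℤ) →
      (P.map (shiftedTime X m)).real {k} = 0 := by
    intro k hk
    rw [hX.map_shiftedTime hm, measureReal_def, Measure.sum_apply _ (MeasurableSet.singleton k)]
    simp only [Measure.smul_apply, smul_eq_mul, Measure.dirac_apply' _ (MeasurableSet.singleton k)]
    rw [ENNReal.tsum_eq_zero.2, ENNReal.toReal_zero]
    intro s
    rw [Set.indicator_of_notMem, mul_zero]
    exact fun hs => hk ⟨s, hs⟩
  rw [← tsum_excessLaw_mul_pow hD hz.le, ← (Nat.cast_injective (R := ℤ)).hasSum_iff]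
  · have hcongr : ∀ s : ℕ, ((fun i : ℤ => (((P.map (shiftedTime X m)).real {i} : ℝ) : ℂ)
        * Complex.exp (Complex.I * t * i)) ∘ (Nat.cast : ℕ → ℤ)) s
        = excessLaw n (n - m - 1) s * Complex.exp (Complex.I * t) ^ s := fun s => by
      simp only [Function.comp_apply, hreal, hpow]
    rw [funext hcongr]
    simp only [Complex.real_smul, hpow] at h
    exact h.summable.hasSum
  · intro k hk
    rw [hneg k hk, Complex.ofReal_zero, zero_mul]

end Law

/-! ### Fourier inversion on the integers -/

theorem integral_exp_I_mul_int (k : ℤ) :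
    ∫ t in (-Real.pi)..Real.pi, Complex.exp (Complex.I * t * k)
      = if k = 0 then 2 * (Real.pi : ℂ) else 0 := by
  split_ifs with hk
  · subst hk
    simp only [Int.cast_zero, mul_zero, Complex.exp_zero, intervalIntegral.integral_const,
      Complex.real_smul, mul_one]
    push_cast
    ring
  · have hc : Complex.I * (k : ℂ) ≠ 0 :=
      mul_ne_zero Complex.I_ne_zero (by exact_mod_cast hk)
    have h := integral_exp_mul_complex (a := -Real.pi) (b := Real.pi) hc
    have he : ∀ t : ℝ, Complex.I * t * k = Complex.I * k * t := fun t => by ring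
    simp only [he]
    rw [h, div_eq_zero_iff]
    left
    rw [sub_eq_zero, Complex.exp_eq_exp_iff_exists_int]
    exact ⟨k, by push_cast; ring⟩

/-- A coefficient of an absolutely convergent Fourier series is bounded by the mean of any bound
for the sum of the series. -/
theorem norm_coeff_le_of_hasSum {a : ℤ → ℂ} {φ : ℝ → ℂ} {g : ℝ → ℝ}
    (h : ∀ t : ℝ, HasSum (fun i : ℤ => a i * Complex.exp (Complex.I * t * i)) (φ t))
    (hg : Continuous g) (hφ : ∀ t, |t| ≤ Real.pi → ‖φ t‖ ≤ g t) (k : ℤ) :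
    ‖a k‖ ≤ ∫ t in (-Real.pi)..Real.pi, g t := by
  have hpi := Real.pi_pos
  have hnorm : ∀ (t : ℝ) (j : ℤ), ‖Complex.exp (Complex.I * t * j)‖ = 1 := fun t j => by
    have : Complex.I * t * j = ((t * j : ℝ) : ℂ) * Complex.I := by push_cast; ring
    rw [this, Complex.norm_exp_ofReal_mul_I]
  have hsum : Summable fun i => ‖a i‖ := by
    simpa using (h 0).summable.norm
  have hexp : ∀ (t : ℝ) (i : ℤ), a i * Complex.exp (Complex.I * t * (i - k : ℤ))
      = a i * Complex.exp (Complex.I * t * i) * Complex.exp (Complex.I * t * (-k : ℤ)) := by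
    intro t i
    rw [mul_assoc (a i), ← Complex.exp_add]
    push_cast
    ring_nf
  have hS : HasSum (fun i : ℤ => ∫ t in (-Real.pi)..Real.pi,
      a i * Complex.exp (Complex.I * t * (i - k : ℤ)))
      (∫ t in (-Real.pi)..Real.pi, φ t * Complex.exp (Complex.I * t * (-k : ℤ))) := by
    refine intervalIntegral.hasSum_integral_of_dominated_convergence (fun i _ => ‖a i‖)
      (fun i => Continuous.aestronglyMeasurable (by fun_prop)) ?_ ?_ ?_ ?_
    · exact fun i => Filter.Eventually.of_forall fun t _ => by rw [norm_mul, hnorm, mul_one]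
    · exact Filter.Eventually.of_forall fun t _ => hsum
    · exact intervalIntegrable_const
    · refine Filter.Eventually.of_forall fun t _ => ?_
      simp only [hexp]
      exact (h t).mul_right _
  have hS' := hS.unique (hasSum_single (f := fun i : ℤ => ∫ t in (-Real.pi)..Real.pi,
      a i * Complex.exp (Complex.I * t * (i - k : ℤ))) k fun i hi => by
    rw [intervalIntegral.integral_const_mul, integral_exp_I_mul_int, if_neg (by omega), mul_zero])
  rw [intervalIntegral.integral_const_mul, integral_exp_I_mul_int, if_pos (sub_self k)] at hS'
  have hle : ‖∫ t in (-Real.pi)..Real.pi, φ t * Complex.exp (Complex.I * t * (-k : ℤ))‖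
      ≤ ∫ t in (-Real.pi)..Real.pi, g t := by
    refine intervalIntegral.norm_integral_le_of_norm_le (by linarith) ?_
      (hg.intervalIntegrable _ _)
    refine Filter.Eventually.of_forall fun t ht => ?_
    rw [norm_mul, hnorm, mul_one]
    exact hφ t (abs_le.2 ⟨ht.1.le, ht.2⟩)
  refine le_trans ?_ hle
  rw [hS', norm_mul, norm_mul, Complex.norm_real, Real.norm_of_nonneg hpi.le, Complex.norm_ofNat]
  -- Inversion bounds 2π ‖a k‖; the factor 2π ≥ 1 is simply discarded.
  nlinarith [norm_nonneg (a k), Real.pi_gt_three]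

/-- The moments of the modulus of the characteristic function of a Poisson distribution. -/
theorem exists_integral_exp_mul_cos_le (j : ℕ) :
    ∃ C : ℝ, 0 ≤ C ∧ ∀ s v : ℝ, 0 < s → s ^ 2 ≤ v →
      ∫ t in (-Real.pi)..Real.pi, Real.exp (v * (Real.cos t - 1))
        * ‖Complex.exp (Complex.I * t) - 1‖ ^ j ≤ C / s ^ (j + 1) := by
  have hpi := Real.pi_pos
  -- On [-π, π], cos t - 1 ≤ -(2/π²) t² and |e^{it} - 1| ≤ |t|. The substitution y = s t then
  -- produces the power s^{-(j+1)}.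
  set b : ℝ := 2 / Real.pi ^ 2 with hb
  have hb0 : 0 < b := by positivity
  set G : ℝ → ℝ := fun y => Real.exp (-b * y ^ 2) * |y| ^ j with hG
  have hG0 : ∀ y, 0 ≤ G y := fun y => by positivity
  have hGi : Integrable G := by
    have h := (integrable_rpow_mul_exp_neg_mul_sq hb0 (s := j) (by
      have : (0 : ℝ) ≤ j := by positivity
      linarith)).norm
    refine h.congr (Filter.Eventually.of_forall fun y => ?_)
    simp only [Real.rpow_natCast, norm_mul, norm_pow, Real.norm_eq_abs, Real.abs_exp, hG]
    ring
  refine ⟨∫ y, G y, integral_nonneg hG0, fun s v hs hv => ?_⟩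
  have hGs : Integrable fun t => G (s * t) := hGi.comp_mul_left' hs.ne'
  have hpt : ∀ t ∈ Set.Icc (-Real.pi) Real.pi, Real.exp (v * (Real.cos t - 1))
        * ‖Complex.exp (Complex.I * t) - 1‖ ^ j ≤ (s ^ j)⁻¹ * G (s * t) := by
    intro t ht
    have h1 : ‖Complex.exp (Complex.I * t) - 1‖ ≤ |t| := by
      simpa using Real.norm_exp_I_mul_ofReal_sub_one_le (x := t)
    have h2 := Real.cos_le_one_sub_mul_cos_sq (abs_le.2 ht)
    have h3 : v * (Real.cos t - 1) ≤ -b * (s * t) ^ 2 := by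
      have h4 : 0 ≤ b * t ^ 2 := by positivity
      nlinarith
    have h5 : (s ^ j)⁻¹ * G (s * t) = Real.exp (-b * (s * t) ^ 2) * |t| ^ j := by
      simp only [hG, abs_mul, abs_of_pos hs, mul_pow]
      field_simp
    rw [h5]
    gcongr
  have hcont : Continuous fun t : ℝ => Real.exp (v * (Real.cos t - 1))
        * ‖Complex.exp (Complex.I * t) - 1‖ ^ j := by fun_prop
  calc ∫ t in (-Real.pi)..Real.pi, Real.exp (v * (Real.cos t - 1))
        * ‖Complex.exp (Complex.I * t) - 1‖ ^ j
      ≤ ∫ t in (-Real.pi)..Real.pi, (s ^ j)⁻¹ * G (s * t) :=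
        intervalIntegral.integral_mono_on (by linarith) (hcont.intervalIntegrable _ _)
          ((hGs.const_mul _).intervalIntegrable) hpt
    _ = ∫ t in Set.Ioc (-Real.pi) Real.pi, (s ^ j)⁻¹ * G (s * t) :=
        intervalIntegral.integral_of_le (by linarith)
    _ ≤ ∫ t, (s ^ j)⁻¹ * G (s * t) :=
        setIntegral_le_integral (hGs.const_mul _) (Filter.Eventually.of_forall fun t =>
          mul_nonneg (by positivity) (hG0 _))
    _ = (∫ y, G y) / s ^ (j + 1) := by
        rw [integral_const_mul, Measure.integral_comp_mul_left, smul_eq_mul, abs_inv,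
          abs_of_pos hs, pow_succ]
        field_simp

/-! ### Expansion of the characteristic function -/

section Expansion

variable {ι : Type*} (S : Finset ι) (x : ι → ℝ)

/-- The power sum `∑ x_i^r`. -/
noncomputable def powerSum (r : ℕ) : ℝ := ∑ i ∈ S, x i ^ r

/-- The truncation at the order `R` of the logarithm of `e^{-(p_1 + p_2) w} ∏ (1 - x_i w)⁻¹`, where
`p_r` is the `r`-th power sum of the `x_i`. -/
noncomputable def truncLog (R : ℕ) (w : ℂ) : ℂ :=
  -(powerSum S x 2 * w) + (powerSum S x 2 / 2 : ℝ) * w ^ 2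
    + ∑ r ∈ Finset.Icc 3 R, (powerSum S x r / (r : ℝ) : ℝ) * w ^ r

variable {S x}

theorem powerSum_nonneg (hx : ∀ i ∈ S, 0 ≤ x i) (r : ℕ) : 0 ≤ powerSum S x r :=
  Finset.sum_nonneg fun i hi => pow_nonneg (hx i hi) r

theorem powerSum_anti (hx : ∀ i ∈ S, 0 ≤ x i) (hx1 : ∀ i ∈ S, x i ≤ 1) {r r' : ℕ} (h : r ≤ r') :
    powerSum S x r' ≤ powerSum S x r :=
  Finset.sum_le_sum fun i hi => pow_le_pow_of_le_one (hx i hi) (hx1 i hi) h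

theorem neg_logTaylor_neg (R : ℕ) (z : ℂ) :
    -Complex.logTaylor (R + 1) (-z) = ∑ r ∈ Finset.range (R + 1), z ^ r / r := by
  rw [Complex.logTaylor, ← Finset.sum_neg_distrib]
  refine Finset.sum_congr rfl fun r _ => ?_
  have h : (-1 : ℂ) ^ r * (-1) ^ r = 1 := by
    rw [← mul_pow]
    norm_num
  rw [neg_pow z r, pow_succ]
  linear_combination (z ^ r / r) * h

/-- The Taylor polynomials add up to ∑ p_r w^r / r. The linear term p_1 w is written as (p_1 + p_2)
w - p_2 w, which is where the linear term of h_R comes from. -/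
theorem sum_neg_logTaylor_neg {R : ℕ} (hR : 3 ≤ R) (w : ℂ) :
    ∑ i ∈ S, -Complex.logTaylor (R + 1) (-((x i : ℂ) * w))
      = (powerSum S x 1 + powerSum S x 2 : ℝ) * w + truncLog S x R w := by
  simp only [neg_logTaylor_neg]
  rw [Finset.sum_comm]
  have h1 : ∀ r : ℕ, ∑ i ∈ S, ((x i : ℂ) * w) ^ r / r
      = (powerSum S x r / (r : ℝ) : ℝ) * w ^ r := by
    intro r
    rw [powerSum]
    push_cast
    rw [Finset.sum_div, Finset.sum_mul]
    exact Finset.sum_congr rfl fun i _ => by rw [mul_pow]; ring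
  have h2 : Finset.Icc 3 R = Finset.Ico 3 (R + 1) := by
    ext r
    simp only [Finset.mem_Icc, Finset.mem_Ico]
    omega
  simp only [h1]
  rw [truncLog, h2, Finset.range_eq_Ico,
    ← Finset.sum_Ico_consecutive _ (Nat.zero_le 3) (by omega : 3 ≤ R + 1)]
  rw [← Finset.range_eq_Ico, Finset.sum_range_succ, Finset.sum_range_succ, Finset.sum_range_succ,
    Finset.sum_range_zero]
  push_cast
  -- The summand r = 0 is a division by zero, hence 0.
  simp only [div_zero]
  ring

/-- Every term contains a factor w and a power sum p_r ≤ p_2, because r ≥ 2 and 0 ≤ x_i ≤ 1; the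
remaining powers of w are at most powers of 2. -/
theorem norm_truncLog_le (hx : ∀ i ∈ S, 0 ≤ x i) (hx1 : ∀ i ∈ S, x i ≤ 1) (R : ℕ) {w : ℂ}
    (hw : ‖w‖ ≤ 2) :
    ‖truncLog S x R w‖ ≤ (2 + ∑ r ∈ Finset.Icc 3 R, 2 ^ (r - 1)) * (powerSum S x 2 * ‖w‖) := by
  have hp := powerSum_nonneg hx
  rw [truncLog, add_mul]
  refine (norm_add_le _ _).trans (add_le_add ((norm_add_le _ _).trans ?_) ?_)
  · rw [norm_neg, norm_mul, norm_mul, norm_pow, Complex.norm_real, Complex.norm_real,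
      Real.norm_of_nonneg (hp 2), Real.norm_of_nonneg (by linarith [hp 2])]
    nlinarith [mul_nonneg (mul_nonneg (hp 2) (norm_nonneg w)) (sub_nonneg.2 hw)]
  · rw [Finset.sum_mul]
    refine (norm_sum_le _ _).trans (Finset.sum_le_sum fun r hr => ?_)
    obtain ⟨h3, -⟩ := Finset.mem_Icc.1 hr
    have hr1 : (1 : ℝ) ≤ r := by exact_mod_cast (by omega : 1 ≤ r)
    rw [norm_mul, norm_pow, Complex.norm_real,
      Real.norm_of_nonneg (div_nonneg (hp r) (by linarith))]
    calc powerSum S x r / r * ‖w‖ ^ r ≤ powerSum S x 2 * ‖w‖ ^ r := by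
          gcongr
          exact (div_le_self (hp r) hr1).trans (powerSum_anti hx hx1 (by omega))
      _ = powerSum S x 2 * (‖w‖ ^ (r - 1) * ‖w‖) := by rw [← pow_succ, Nat.sub_add_cancel (by omega)]
      _ ≤ powerSum S x 2 * (2 ^ (r - 1) * ‖w‖) := by
          gcongr
          exact hp 2
      _ = 2 ^ (r - 1) * (powerSum S x 2 * ‖w‖) := by ring

theorem prod_inv_eq_exp {w : ℂ} (h : ∀ i ∈ S, ‖(x i : ℂ) * w‖ < 1) :
    ∏ i ∈ S, (1 - (x i : ℂ) * w)⁻¹ = Complex.exp (∑ i ∈ S, Complex.log (1 - (x i : ℂ) * w)⁻¹) := by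
  rw [Complex.exp_sum]
  refine Finset.prod_congr rfl fun i hi => (Complex.exp_log (inv_ne_zero fun h0 => ?_)).symm
  have := h i hi
  rw [← sub_eq_zero.1 h0, norm_one] at this
  exact lt_irrefl _ this

theorem norm_sum_log_sub_le {R : ℕ} (hR : 3 ≤ R) (hx : ∀ i ∈ S, 0 ≤ x i)
    (hx1 : ∀ i ∈ S, x i ≤ 1 / 4) {w : ℂ} (hw : ‖w‖ ≤ 2) :
    ‖∑ i ∈ S, Complex.log (1 - (x i : ℂ) * w)⁻¹
        - ((powerSum S x 1 + powerSum S x 2 : ℝ) * w + truncLog S x R w)‖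
      ≤ powerSum S x (R + 1) * ‖w‖ ^ (R + 1) := by
  rw [← sum_neg_logTaylor_neg hR, ← Finset.sum_sub_distrib, powerSum, Finset.sum_mul]
  refine (norm_sum_le _ _).trans (Finset.sum_le_sum fun i hi => ?_)
  have hz : ‖(x i : ℂ) * w‖ ≤ 1 / 2 := by
    rw [norm_mul, Complex.norm_real, Real.norm_of_nonneg (hx i hi)]
    nlinarith [hx i hi, hx1 i hi, norm_nonneg w]
  rw [sub_neg_eq_add]
  refine (Complex.norm_log_one_sub_inv_add_logTaylor_neg_le R (by linarith)).trans ?_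
  have h2 : (1 - ‖(x i : ℂ) * w‖)⁻¹ ≤ 2 := by
    rw [inv_le_comm₀ (by linarith) (by norm_num)]
    linarith
  have hR' : (3 : ℝ) ≤ R := by exact_mod_cast hR
  -- The factor 2 from the geometric tail is absorbed by R + 1 ≥ 2.
  calc ‖(x i : ℂ) * w‖ ^ (R + 1) * (1 - ‖(x i : ℂ) * w‖)⁻¹ / (R + 1)
      ≤ ‖(x i : ℂ) * w‖ ^ (R + 1) * 2 / 2 := by
        gcongr
        linarith
    _ = x i ^ (R + 1) * ‖w‖ ^ (R + 1) := by
        rw [mul_div_cancel_right₀ _ two_ne_zero, norm_mul, Complex.norm_real,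
          Real.norm_of_nonneg (hx i hi), mul_pow]

/-- The error of the approximation of `∏ (1 - x_i w)⁻¹` by the exponential factor times the partial
sum of length `L` of the exponential series of the truncated logarithm. -/
theorem exists_norm_prod_sub_le {R : ℕ} (hR : 3 ≤ R) (L : ℕ) :
    ∃ K : ℝ, 0 ≤ K ∧ ∀ {ι : Type} (S : Finset ι) (x : ι → ℝ) (w : ℂ), (∀ i ∈ S, 0 ≤ x i) →
      (∀ i ∈ S, x i ≤ 1 / 4) → ‖w‖ ≤ 2 → powerSum S x 2 ≤ 1 →
      ‖∏ i ∈ S, (1 - (x i : ℂ) * w)⁻¹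
          - Complex.exp ((powerSum S x 1 + powerSum S x 2 : ℝ) * w)
            * ∑ l ∈ Finset.range L, truncLog S x R w ^ l / l.factorial‖
        ≤ Real.exp ((powerSum S x 1 + powerSum S x 2) * w.re)
          * (K * powerSum S x (R + 1) * ‖w‖ ^ (R + 1) + K * powerSum S x 2 ^ L * ‖w‖ ^ L) := by
  set B : ℝ := 2 + ∑ r ∈ Finset.Icc 3 R, 2 ^ (r - 1) with hB
  have hB0 : 0 ≤ B := by positivity
  -- The first summand comes from e^T (e^δ - 1), with δ the error of the truncated logarithm T; the
  -- second from the remainder of the exponential series at T. Their sum serves both error terms.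
  refine ⟨Real.exp (B * 2) * Real.exp (2 ^ (R + 1)) + B ^ L * Real.exp (B * 2), by positivity, ?_⟩
  intro ι S x w hx hx4 hw hp2
  have hx1 : ∀ i ∈ S, x i ≤ 1 := fun i hi => (hx4 i hi).trans (by norm_num)
  have hp := powerSum_nonneg hx
  have hT : ‖truncLog S x R w‖ ≤ B * (powerSum S x 2 * ‖w‖) := norm_truncLog_le hx hx1 R hw
  have hT2 : ‖truncLog S x R w‖ ≤ B * 2 := hT.trans (by
    gcongr
    nlinarith [hp 2, norm_nonneg w])
  have hprod := prod_inv_eq_exp (S := S) (x := x) (w := w) fun i hi => by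
    rw [norm_mul, Complex.norm_real, Real.norm_of_nonneg (hx i hi)]
    nlinarith [hx i hi, hx4 i hi, norm_nonneg w]
  have hδ := norm_sum_log_sub_le hR hx hx4 hw
  set v : ℝ := powerSum S x 1 + powerSum S x 2
  set T := truncLog S x R w
  set δ : ℂ := ∑ i ∈ S, Complex.log (1 - (x i : ℂ) * w)⁻¹ - ((v : ℂ) * w + T) with hδdef
  have hδ2 : ‖δ‖ ≤ 2 ^ (R + 1) := by
    refine hδ.trans ?_
    calc powerSum S x (R + 1) * ‖w‖ ^ (R + 1) ≤ 1 * 2 ^ (R + 1) := by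
          gcongr
          exact (powerSum_anti hx hx1 (by omega)).trans hp2
      _ = 2 ^ (R + 1) := one_mul _
  have hsplit : ∏ i ∈ S, (1 - (x i : ℂ) * w)⁻¹
      - Complex.exp (v * w) * ∑ l ∈ Finset.range L, T ^ l / l.factorial
      = Complex.exp (v * w) * (Complex.exp T * (Complex.exp δ - 1)
        + (Complex.exp T - ∑ l ∈ Finset.range L, T ^ l / l.factorial)) := by
    have : ∑ i ∈ S, Complex.log (1 - (x i : ℂ) * w)⁻¹ = v * w + T + δ := by
      rw [hδdef]; ring
    rw [hprod, this, Complex.exp_add, Complex.exp_add]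
    ring
  have hexpv : ‖Complex.exp (v * w)‖ = Real.exp (v * w.re) := by
    rw [Complex.norm_exp, Complex.re_ofReal_mul]
  have hexpT : ‖Complex.exp T‖ ≤ Real.exp (B * 2) := by
    rw [Complex.norm_exp]
    exact Real.exp_le_exp.2 ((Complex.re_le_norm T).trans hT2)
  have hexpδ : ‖Complex.exp δ - 1‖ ≤ ‖δ‖ * Real.exp (2 ^ (R + 1)) := by
    have h := Complex.norm_exp_sub_sum_le_norm_mul_exp δ 1
    simp only [Finset.sum_range_one, pow_zero, Nat.factorial_zero, Nat.cast_one, div_one,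
      pow_one] at h
    exact h.trans (by gcongr)
  have hexpL : ‖Complex.exp T - ∑ l ∈ Finset.range L, T ^ l / l.factorial‖
      ≤ (B * (powerSum S x 2 * ‖w‖)) ^ L * Real.exp (B * 2) :=
    (Complex.norm_exp_sub_sum_le_norm_mul_exp T L).trans (by
      gcongr
      exact pow_nonneg ((norm_nonneg T).trans hT) L)
  rw [hsplit, norm_mul, hexpv]
  refine mul_le_mul_of_nonneg_left ?_ (Real.exp_pos _).le
  refine (norm_add_le _ _).trans ?_
  rw [norm_mul]
  have hA : 0 ≤ powerSum S x (R + 1) * ‖w‖ ^ (R + 1) := mul_nonneg (hp _) (by positivity)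
  have hA2 : 0 ≤ powerSum S x 2 ^ L * ‖w‖ ^ L := mul_nonneg (pow_nonneg (hp _) _) (by positivity)
  have h1 : ‖Complex.exp T‖ * ‖Complex.exp δ - 1‖ ≤ Real.exp (B * 2) * Real.exp (2 ^ (R + 1))
      * (powerSum S x (R + 1) * ‖w‖ ^ (R + 1)) := by
    calc ‖Complex.exp T‖ * ‖Complex.exp δ - 1‖
        ≤ Real.exp (B * 2) * (‖δ‖ * Real.exp (2 ^ (R + 1))) := by gcongr
      _ ≤ Real.exp (B * 2) * (powerSum S x (R + 1) * ‖w‖ ^ (R + 1) * Real.exp (2 ^ (R + 1))) := by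
          gcongr
      _ = _ := by ring
  have h2 : (B * (powerSum S x 2 * ‖w‖)) ^ L * Real.exp (B * 2)
      = B ^ L * Real.exp (B * 2) * (powerSum S x 2 ^ L * ‖w‖ ^ L) := by
    rw [mul_pow, mul_pow]; ring
  have h3 : 0 ≤ Real.exp (B * 2) * Real.exp (2 ^ (R + 1)) := by positivity
  have h4 : 0 ≤ B ^ L * Real.exp (B * 2) := by positivity
  nlinarith [mul_nonneg h3 hA2, mul_nonneg h4 hA]

end Expansion

/-! ### Size of the coefficients -/

theorem oddsSum_eq_powerSum (n j r : ℕ) :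
    oddsSum n j r = powerSum (Finset.range (j + 1)) (fun i : ℕ => (i : ℝ) / ((n : ℝ) - i)) r := rfl

theorem odds_nonneg {n j : ℕ} (hj : j < n) : ∀ i ∈ Finset.range (j + 1),
    (0 : ℝ) ≤ (i : ℝ) / ((n : ℝ) - i) := by
  intro i hi
  have : (i : ℝ) < n := by exact_mod_cast (Finset.mem_range_succ_iff.1 hi).trans_lt hj
  exact div_nonneg (by positivity) (by linarith)

theorem sum_pow_div_le_oddsSum {n j : ℕ} (hj : j < n) (r : ℕ) :
    (∑ i ∈ Finset.range (j + 1), (i : ℝ) ^ r) / (n : ℝ) ^ r ≤ oddsSum n j r := by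
  rw [oddsSum, Finset.sum_div]
  refine Finset.sum_le_sum fun i hi => ?_
  have hi' : (i : ℝ) < n := by exact_mod_cast (Finset.mem_range_succ_iff.1 hi).trans_lt hj
  have : (0 : ℝ) < n - i := by linarith
  have hi0 : (0 : ℝ) ≤ i := by positivity
  rw [← div_pow]
  gcongr
  linarith

/-- This lower bound for the variance is s² with s = D/(2√n), the scale of the Gaussian integrals.
-/
theorem sq_div_le_oddsSum_one {n j : ℕ} (hj : j < n) :
    (j : ℝ) ^ 2 / (4 * n) ≤ oddsSum n j 1 := by
  have hn : (0 : ℝ) < n := by exact_mod_cast (by omega : 0 < n)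
  have h : ∀ j : ℕ, (j : ℝ) ^ 2 / 4 ≤ ∑ i ∈ Finset.range (j + 1), (i : ℝ) ^ 1 := by
    intro j
    induction j with
    | zero => simp
    | succ j ih =>
      rw [Finset.sum_range_succ]
      push_cast at ih ⊢
      nlinarith [(Nat.cast_nonneg j : (0 : ℝ) ≤ j)]
  refine le_trans ?_ (sum_pow_div_le_oddsSum hj 1)
  rw [pow_one, ← div_div]
  gcongr
  exact h j

theorem pow_three_le_of_oddsSum_two_le {n j : ℕ} (hj : j < n) (h : oddsSum n j 2 ≤ 1) :
    (j : ℝ) ^ 3 ≤ 3 * (n : ℝ) ^ 2 := by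
  have hn : (0 : ℝ) < n := by exact_mod_cast (by omega : 0 < n)
  have hs : ∀ j : ℕ, (j : ℝ) ^ 3 / 3 ≤ ∑ i ∈ Finset.range (j + 1), (i : ℝ) ^ 2 := by
    intro j
    induction j with
    | zero => simp
    | succ j ih =>
      rw [Finset.sum_range_succ]
      push_cast at ih ⊢
      nlinarith [(Nat.cast_nonneg j : (0 : ℝ) ≤ j)]
  have h1 := (sum_pow_div_le_oddsSum hj 2).trans h
  rw [div_le_one (by positivity)] at h1
  linarith [hs j]

theorem odds_le {n j : ℕ} (hn : 0 < n) (hj : 8 * j ≤ n) : ∀ i ∈ Finset.range (j + 1),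
    (i : ℝ) / ((n : ℝ) - i) ≤ 2 * j / n ∧ (i : ℝ) / ((n : ℝ) - i) ≤ 1 / 4 := by
  intro i hi
  have hn' : (0 : ℝ) < n := by exact_mod_cast hn
  have hij : (i : ℝ) ≤ j := by exact_mod_cast Finset.mem_range_succ_iff.1 hi
  have hjn : 8 * (j : ℝ) ≤ n := by exact_mod_cast hj
  have hj0 : (0 : ℝ) ≤ j := by positivity
  have hd : (0 : ℝ) < n - i := by linarith
  constructor
  · rw [div_le_div_iff₀ hd hn']
    nlinarith
  · rw [div_le_div_iff₀ hd (by norm_num)]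
    linarith

theorem oddsSum_le {n j : ℕ} (hn : 0 < n) (hj : 8 * j ≤ n) {r : ℕ} (hr : r ≠ 0) :
    oddsSum n j r ≤ j * (2 * j / n) ^ r := by
  -- The term i = 0 vanishes, so only j terms count and the bound is 0 at j = 0.
  rw [oddsSum, Finset.sum_range_succ']
  simp only [Nat.cast_zero, zero_div, zero_pow hr, add_zero]
  refine (Finset.sum_le_card_nsmul _ _ ((2 * j / n : ℝ) ^ r) fun i hi => ?_).trans_eq (by simp)
  have hi' : i + 1 ∈ Finset.range (j + 1) := by
    rw [Finset.mem_range] at hi ⊢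
    omega
  exact pow_le_pow_left₀ (odds_nonneg (by omega) _ hi') (odds_le hn hj _ hi').1 r

/-! ### The polynomials of the expansion -/

theorem aeval_hPoly {n m : ℕ} (hm : m < n) (R : ℕ) (w : ℂ) :
    aeval w (hPoly R n m) = truncLog (Finset.range (n - m - 1 + 1))
      (fun i : ℕ => (i : ℝ) / ((n : ℝ) - i)) R w := by
  simp only [hPoly, truncLog, aSum_eq_oddsSum hm, oddsSum_eq_powerSum, map_add, map_neg, map_mul,
    map_pow, map_sum, aeval_C, aeval_X, Complex.coe_algebraMap]

theorem aeval_HPoly {n m R : ℕ} (hm : m < n) (hR : 3 ≤ R) (w : ℂ) :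
    aeval w (HPoly R n m) = ∑ l ∈ Finset.range (3 * R - 1),
      truncLog (Finset.range (n - m - 1 + 1)) (fun i : ℕ => (i : ℝ) / ((n : ℝ) - i)) R w ^ l
        / l.factorial := by
  have h : Finset.Icc 0 (3 * R - 2) = Finset.range (3 * R - 1) := by
    ext l
    simp only [Finset.mem_Icc, Finset.mem_range]
    omega
  rw [HPoly, h, map_sum]
  refine Finset.sum_congr rfl fun l _ => ?_
  rw [map_mul, map_pow, aeval_hPoly hm, aeval_C, Complex.coe_algebraMap]
  push_cast
  ring

/-! ### The error bound -/

/-- Here ρ is √n. The powers D^{R+2} cancel, so no bound on D is needed. -/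
theorem tail_term_le {ρ D A C s : ℝ} {R : ℕ} (hρ : 0 < ρ) (hD : 0 < D) (hC : 0 ≤ C)
    (hs : s = D / (2 * ρ)) (hA : A ≤ D * (2 * D / ρ ^ 2) ^ (R + 1)) :
    A * (C / s ^ (R + 1 + 1)) ≤ C * 2 ^ (2 * R + 3) * (1 / ρ ^ R) := by
  have hs0 : 0 < s := by rw [hs]; positivity
  calc A * (C / s ^ (R + 1 + 1))
      ≤ D * (2 * D / ρ ^ 2) ^ (R + 1) * (C / s ^ (R + 1 + 1)) := by gcongr
    _ = C * 2 ^ (2 * R + 3) * (1 / ρ ^ R) := by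
        rw [hs, div_pow, div_pow, mul_pow, mul_pow]
        field_simp
        ring

/-- With L = 3R - 1 the surplus power of D is 2L - 1 = 3(2R - 1), a power of D³ ≤ 3ρ⁴; this leaves
exactly ρ^{-R}. -/
theorem exp_term_le {ρ D A C s : ℝ} {R : ℕ} (hR : 3 ≤ R) (hρ : 0 < ρ) (hD : 0 < D) (hC : 0 ≤ C)
    (hs : s = D / (2 * ρ)) (hA0 : 0 ≤ A) (hA : A ≤ D * (2 * D / ρ ^ 2) ^ 2)
    (hD3 : D ^ 3 ≤ 3 * ρ ^ 4) :
    A ^ (3 * R - 1) * (C / s ^ (3 * R - 1 + 1))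
      ≤ C * (4 ^ (3 * R - 1) * 2 ^ (3 * R) * 3 ^ (2 * R - 1)) * (1 / ρ ^ R) := by
  obtain ⟨k, rfl⟩ : ∃ k, R = k + 1 := ⟨R - 1, by omega⟩
  have e1 : 3 * (k + 1) - 1 = 3 * k + 2 := by omega
  have e2 : 2 * (k + 1) - 1 = 2 * k + 1 := by omega
  rw [e1, e2]
  have hs0 : 0 < s := by rw [hs]; positivity
  calc A ^ (3 * k + 2) * (C / s ^ (3 * k + 2 + 1))
      ≤ (D * (2 * D / ρ ^ 2) ^ 2) ^ (3 * k + 2) * (C / s ^ (3 * k + 2 + 1)) := by gcongr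
    _ = C * (4 ^ (3 * k + 2) * 2 ^ (3 * (k + 1))) * ((D ^ 3) ^ (2 * k + 1) / ρ ^ (9 * k + 5)) := by
        have : D * (2 * D / ρ ^ 2) ^ 2 = 4 * D ^ 3 / ρ ^ 4 := by
          field_simp
          ring
        rw [this, hs, div_pow, div_pow, mul_pow, mul_pow]
        field_simp
        ring
    _ ≤ C * (4 ^ (3 * k + 2) * 2 ^ (3 * (k + 1)))
          * ((3 * ρ ^ 4) ^ (2 * k + 1) / ρ ^ (9 * k + 5)) := by gcongr
    _ = C * (4 ^ (3 * k + 2) * 2 ^ (3 * (k + 1)) * 3 ^ (2 * k + 1)) * (1 / ρ ^ (k + 1)) := by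
        rw [mul_pow 3]
        field_simp
        ring

/-- The bound for the point masses. -/
theorem exists_abs_centeredLaw_sub_le {R : ℕ} (hR : 3 ≤ R) :
    ∃ K : ℝ, 0 < K ∧ ∀ (n m : ℕ), m < n → 1536 ≤ n → aSum n m 2 < 1 →
      ∀ {Ω : Type*} [MeasurableSpace Ω] (P : Measure Ω) [IsProbabilityMeasure P]
        (X : ℕ → Ω → Fin n), IsUniformSampling X P → ∀ k : ℤ,
          |(centeredLaw X m P).real {k} - nuR R n m (waitingVar X m P) {k}|
            ≤ K * (1 / Real.sqrt n ^ R) := by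
  obtain ⟨K, hK0, hK⟩ := exists_norm_prod_sub_le hR (3 * R - 1)
  obtain ⟨C₁, hC₁, hI₁⟩ := exists_integral_exp_mul_cos_le (R + 1)
  obtain ⟨C₂, hC₂, hI₂⟩ := exists_integral_exp_mul_cos_le (3 * R - 1)
  -- The final 1 only ensures positivity.
  refine ⟨K * (C₁ * 2 ^ (2 * R + 3))
    + K * (C₂ * (4 ^ (3 * R - 1) * 2 ^ (3 * R) * 3 ^ (2 * R - 1))) + 1, by positivity, ?_⟩
  intro n m hm hn ha Ω _ P _ X hX k
  have hn0 : 0 < n := by omega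
  have hD : n - m - 1 < n := by omega
  have hc : centeredLaw X m P = P.map (shiftedTime X m) := by
    have h0 : 0 ≤ aSum n m 2 := by
      rw [aSum_eq_oddsSum hm, oddsSum_eq_powerSum]
      exact powerSum_nonneg (odds_nonneg hD) 2
    rw [centeredLaw, hX.centering_eq_zero hm h0 ha]
    simp only [add_zero]
  rw [hc, nuR, hX.waitingVar_eq hm]
  rw [aSum_eq_oddsSum hm] at ha
  have hμ := hX.hasSum_shiftedTime hm
  have hν := hasSum_poissonCharlier (aSum n m 1 + aSum n m 2).toNNReal (HPoly R n m)
  rw [aSum_eq_oddsSum hm, aSum_eq_oddsSum hm] at hν ⊢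
  have hH := aeval_HPoly hm hR
  set D := n - m - 1 with hDdef
  have hnR : (1536 : ℝ) ≤ n := by exact_mod_cast hn
  have hD3 := pow_three_le_of_oddsSum_two_le hD ha.le
  -- The threshold is 1536 = 3 · 8³: if 8D > n, then n³ < 8³ D³ ≤ 1536 n².
  have h8 : 8 * D ≤ n := by
    by_contra h
    have h' : (n : ℝ) < 8 * D := by exact_mod_cast not_le.1 h
    have h3 : (n : ℝ) ^ 3 < (8 * D) ^ 3 := by gcongr
    have h2 : (0 : ℝ) ≤ (n : ℝ) ^ 2 * (n - 1536) := by
      have : (0 : ℝ) ≤ n - 1536 := by linarith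
      positivity
    nlinarith
  have hx := odds_nonneg hD
  have hp1 : 0 ≤ oddsSum n D 1 := powerSum_nonneg hx 1
  have hp2 : 0 ≤ oddsSum n D 2 := powerSum_nonneg hx 2
  have hpR : 0 ≤ oddsSum n D (R + 1) := powerSum_nonneg hx (R + 1)
  have hv1 := sq_div_le_oddsSum_one hD
  have hA₁ := oddsSum_le hn0 h8 (Nat.succ_ne_zero R)
  have hA₂ := oddsSum_le hn0 h8 two_ne_zero
  have hlam : ((oddsSum n D 1 + oddsSum n D 2).toNNReal : ℝ) = oddsSum n D 1 + oddsSum n D 2 :=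
    Real.coe_toNNReal _ (by linarith)
  set v := oddsSum n D 1 + oddsSum n D 2 with hv
  set g : ℝ → ℝ := fun t => K * oddsSum n D (R + 1) * (Real.exp (v * (Real.cos t - 1))
      * ‖Complex.exp (Complex.I * t) - 1‖ ^ (R + 1))
    + K * oddsSum n D 2 ^ (3 * R - 1) * (Real.exp (v * (Real.cos t - 1))
      * ‖Complex.exp (Complex.I * t) - 1‖ ^ (3 * R - 1)) with hg
  have hgc : Continuous g := by
    rw [hg]
    fun_prop
  have hmain := norm_coeff_le_of_hasSum
    (a := fun i => (((P.map (shiftedTime X m)).real {i}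
      - poissonCharlier v.toNNReal (HPoly R n m) {i} : ℝ) : ℂ))
    (φ := fun t => (∏ i ∈ Finset.range (D + 1), (1 - ((i : ℝ) / ((n : ℝ) - i) : ℝ)
        * (Complex.exp (Complex.I * t) - 1))⁻¹)
      - Complex.exp (v * (Complex.exp (Complex.I * t) - 1))
        * aeval (Complex.exp (Complex.I * t) - 1) (HPoly R n m))
    (g := g) (fun t => by
      have h := (hμ t).sub (hν t)
      rw [hlam] at h
      convert! h using 2
      rw [Complex.ofReal_sub, sub_mul]) hgc (fun t _ => by
      have hw : ‖Complex.exp (Complex.I * t) - 1‖ ≤ 2 := by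
        refine (norm_sub_le _ _).trans ?_
        rw [mul_comm, Complex.norm_exp_ofReal_mul_I, norm_one]
        norm_num
      have h := hK (Finset.range (D + 1)) (fun i : ℕ => (i : ℝ) / ((n : ℝ) - i))
        (Complex.exp (Complex.I * t) - 1) hx (fun i hi => (odds_le hn0 h8 i hi).2) hw ha.le
      have hre : (Complex.exp (Complex.I * t) - 1).re = Real.cos t - 1 := by
        rw [mul_comm, Complex.sub_re, Complex.exp_ofReal_mul_I_re, Complex.one_re]
      rw [hre, ← hH] at h
      simp only [← oddsSum_eq_powerSum, ← hv] at h
      refine h.trans_eq ?_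
      rw [hg]
      ring) k
  rw [Complex.norm_real, Real.norm_eq_abs] at hmain
  refine hmain.trans ?_
  have hi : ∀ j : ℕ, IntervalIntegrable (fun t : ℝ => Real.exp (v * (Real.cos t - 1))
      * ‖Complex.exp (Complex.I * t) - 1‖ ^ j) volume (-Real.pi) Real.pi := fun j =>
    Continuous.intervalIntegrable (by fun_prop) _ _
  rw [hg, intervalIntegral.integral_add ((hi _).const_mul _) ((hi _).const_mul _),
    intervalIntegral.integral_const_mul, intervalIntegral.integral_const_mul]
  have hρ : 0 < Real.sqrt n := Real.sqrt_pos.2 (by linarith)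
  have hρ2 : Real.sqrt n ^ 2 = n := Real.sq_sqrt (by linarith)
  set ρ := Real.sqrt n
  -- For D = 0 the scale s degenerates, but both error coefficients vanish.
  rcases Nat.eq_zero_or_pos D with h0 | h0
  · have h1 : oddsSum n D (R + 1) = 0 := le_antisymm (hA₁.trans_eq (by simp [h0])) hpR
    have h2 : oddsSum n D 2 = 0 := le_antisymm (hA₂.trans_eq (by simp [h0])) hp2
    rw [h1, h2, zero_pow (by omega)]
    simp only [mul_zero, zero_mul, add_zero]
    positivity
  · have hD0 : (0 : ℝ) < D := by exact_mod_cast h0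
    rw [← hρ2] at hA₁ hA₂ hD3 hv1
    have hs0 : 0 < (D : ℝ) / (2 * ρ) := by positivity
    have hsv : ((D : ℝ) / (2 * ρ)) ^ 2 ≤ v := by
      have : ((D : ℝ) / (2 * ρ)) ^ 2 = (D : ℝ) ^ 2 / (4 * ρ ^ 2) := by
        rw [div_pow, mul_pow]
        norm_num
      rw [this]
      linarith
    have t1 := tail_term_le hρ hD0 hC₁ rfl hA₁
    have t2 := exp_term_le hR hρ hD0 hC₂ rfl hp2 hA₂ (by nlinarith)
    have i1 := mul_le_mul_of_nonneg_left (hI₁ _ v hs0 hsv) hpR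
    have i2 := mul_le_mul_of_nonneg_left (hI₂ _ v hs0 hsv) (pow_nonneg hp2 (3 * R - 1))
    have j1 := mul_le_mul_of_nonneg_left (i1.trans t1) hK0
    have j2 := mul_le_mul_of_nonneg_left (i2.trans t2) hK0
    have hpos : 0 ≤ 1 / ρ ^ R := by positivity
    rw [mul_assoc, mul_assoc]
    refine (add_le_add j1 j2).trans ?_
    linarith

end CouponCollector

theorem theorem7p2 (R : ℕ) (hR : 3 ≤ R) :
    ∃ (nR : ℕ) (CR : ℝ), 0 < CR ∧
      ∀ (n m : ℕ), 2 ≤ n → m < n → nR ≤ n → CouponCollector.aSum n m 2 < 1 →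
        ∀ (Ω : Type*) [MeasurableSpace Ω] (P : MeasureTheory.Measure Ω)
          [MeasureTheory.IsProbabilityMeasure P] (X : ℕ → Ω → Fin n),
          CouponCollector.IsUniformSampling X P →
            BddAbove (Set.range fun k : ℤ =>
              |(CouponCollector.centeredLaw X m P).real {k}
                - CouponCollector.nuR R n m (CouponCollector.waitingVar X m P) {k}|) ∧
            (⨆ k : ℤ, |(CouponCollector.centeredLaw X m P).real {k}
                - CouponCollector.nuR R n m (CouponCollector.waitingVar X m P) {k}|)
              ≤ CR * (1 / Real.sqrt n ^ R) := by
  obtain ⟨K, hK0, hK⟩ := CouponCollector.exists_abs_centeredLaw_sub_le hR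
  refine ⟨1536, K, hK0, fun n m _ hm hn ha Ω _ P _ X hX => ?_⟩
  have h := hK n m hm hn ha P X hX
  exact ⟨⟨_, Set.forall_mem_range.2 h⟩, ciSup_le h⟩
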